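/- **Theorem 5 (Long-time fluctuations in the regularized case).** *Setting.* Let $\Omega\subset\mathbb R^d$ be compact, $D$ a Euclidean space $\mathbb R^k$ or a subset of it, and $\varphi(\theta,x)$, $\theta\in D$, $x\in\Omega$, an activation function which is twice continuously differentiable in $\theta$ (in a neighbourhood of each point of $D$) and whose Hessian $\nabla\nabla\varphi(\theta,x)$ is Lipschitz in $\theta\in D$, uniformly in $x$. Let $x_1,\dots,x_n\in\Omega$ ($n\ge1$), $\hat\nu=\frac1n\sum_l\delta_{x_l}$, $\|h\|_{\hat\nu}^2=\int|h|^2d\hat\nu$, let $f_*:\Omega\to\mathbb R$ be a target function, $\lambda\ge0$, and let $r$ be a regularizer which is twice continuously differentiable near each point of $D$, with locally Lipschitz Hessian on $D$. Put $f[\mu]=\int\varphi(\theta,\cdot)\,\mu(d\theta)$, $$F(\theta)=\int f_*(x)\varphi(\theta,x)\hat\nu(dx)-\lambda r(\theta),\quad K(\theta,\theta')=\int\varphi(\theta,x)\varphi(\theta',x)\hat\nu(dx),\quad V(\theta,\mu)=-F(\theta)+\int K(\theta,\theta')\mu(d\theta').$$ Let $\mu_0$ be a probability measure with compact support contained in $D$,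 and suppose that the characteristic flow of the mean-field gradient flow, $$\dot\Theta_t(\theta)=-\nabla V(\Theta_t(\theta),\mu_t),\qquad\Theta_0(\theta)=\theta,\qquad\mu_t=(\Theta_t)_\#\mu_0,$$ exists in $D$ for all $t\ge0$ and $\theta\in\operatorname{supp}\mu_0$, continuously in $(t,\theta)$, and that $\Theta_t\to\Theta_\infty$ $\mu_0$-almost surely as $t\to\infty$, where $\Theta_\infty$ maps $\operatorname{supp}\mu_0$ into $D$. Let $\mu_\infty=(\Theta_\infty)_\#\mu_0$ (the weak limit of $\mu_t$) and $f_\infty=f[\mu_\infty]$. *Fluctuations.* Let $\omega_0$ be the Gaussian random measure (Gaussian field on $L^2(\mu_0)$) with mean zero and covariance $\mathbb E[\omega_0(d\theta)\omega_0(d\theta')]=\mu_0(d\theta)\delta_\theta(d\theta')-\mu_0(d\theta)\mu_0(d\theta')$. Let the random vectors $T_t(\theta)$ (square integrable, mean-square continuous in $(t,\theta)\in[0,\infty)\times\operatorname{supp}\mu_0$) solve, with the time derivative taken in mean square, $T_0=0$ and $$\dot T_t(\theta)=-\nabla\nabla V(\Theta_t(\theta),\mu_t)T_t(\theta)-\int\nabla'\nabla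 K(\Theta_t(\theta),\Theta_t(\theta'))T_t(\theta')\mu_0(d\theta')-\int\nabla K(\Theta_t(\theta),\Theta_t(\theta'))\omega_0(d\theta').$$ The limiting fluctuation of the represented function (at scale $m^{-1/2}$, for $m$ particles drawn i.i.d. from $\mu_0$) is $$g_t(x)=\int\varphi(\Theta_t(\theta),x)\,\omega_0(d\theta)+\int\nabla\varphi(\Theta_t(\theta),x)\cdot T_t(\theta)\,\mu_0(d\theta).$$ *Hypotheses.* Suppose that there is $\sigma>0$ with $\nabla\nabla V(\theta,\mu_\infty)\succ\sigma\,\mathrm{Id}$ for all $\theta\in\operatorname{supp}\mu_\infty$, and that (a) or (b) holds: (a) $\sup_{\theta\in\operatorname{supp}\mu_0}|\Theta_t(\theta)-\Theta_\infty(\theta)|=O(t^{-\alpha})$ as $t\to\infty$, for some $\alpha>3/2$; (b) $D'=\{\Theta_t(\theta):t\ge0,\ \theta\in\operatorname{supp}\mu_0\}$ is relatively compact in $D$, and $$\int_0^\infty\!\!\int\big(|\Theta_t(\theta)-\Theta_\infty(\theta)|+U_t(\theta)^2\big)e^{C_1(U_t(\theta)+\bar U_t)}\mu_0(d\theta)\,dt<\infty,\qquad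 U_t(\theta)=\int_t^\infty|\Theta_s(\theta)-\Theta_\infty(\theta)|ds,\quad\bar U_t=\int U_t\,d\mu_0,$$ where $C_1=C_1(M)>0$ is a suitable constant depending only on a number $M$ that bounds $|f_*(x_l)|$, the absolute values and the Lipschitz constants over $D'$ of $\varphi(\cdot,x_l)$, $\nabla\varphi(\cdot,x_l)$, $\nabla\nabla\varphi(\cdot,x_l)$ ($1\le l\le n$), and the Lipschitz constant over $D'$ of $\lambda\nabla\nabla r$. *Conclusion.* Then $$\limsup_{T\to\infty}\frac1T\int_0^T\mathbb E\|g_t\|_{\hat\nu}^2\,dt\ \le\ \int\|\varphi(\theta,\cdot)\|_{\hat\nu}^2\,\mu_\infty(d\theta)-\|f_\infty\|_{\hat\nu}^2 .$$ -/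

import Mathlib

open MeasureTheory ProbabilityTheory Filter Topology Set
open scoped ENNReal NNReal

noncomputable section

namespace MeanFieldERM

/-- The Hessian `∇∇f(θ)`, as a linear operator. -/
def hess {k : ℕ} (f : EuclideanSpace ℝ (Fin k) → ℝ) (θ : EuclideanSpace ℝ (Fin k)) :
    EuclideanSpace ℝ (Fin k) →L[ℝ] EuclideanSpace ℝ (Fin k) :=
  fderiv ℝ (gradient f) θ

/-- The data of a regularized empirical risk minimization problem over measures on the parameter
space `D`: activation `φ(θ, x)`, target `f_*`, regularizer `r`, regularization strength `lam`, and
data points `x₁, …, xₙ ∈ Ω`. -/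
structure Problem (k d n : ℕ) where
  D : Set (EuclideanSpace ℝ (Fin k))
  Ω : Set (EuclideanSpace ℝ (Fin d))
  φ : EuclideanSpace ℝ (Fin k) → EuclideanSpace ℝ (Fin d) → ℝ
  fstar : EuclideanSpace ℝ (Fin d) → ℝ
  r : EuclideanSpace ℝ (Fin k) → ℝ
  lam : ℝ
  x : Fin n → EuclideanSpace ℝ (Fin d)

variable {k d n : ℕ}

namespace Problem

/-- The standing regularity assumptions. `D` is any subset of a Euclidean space; derivatives at
points of `D` are ambient derivatives. On an open `D`, `C²` at every point is implied by twice
differentiability and the Lipschitz property of the Hessian. -/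
structure Regular (p : Problem k d n) : Prop where
  n_pos : 0 < n
  isCompact_Ω : IsCompact p.Ω
  x_mem : ∀ l, p.x l ∈ p.Ω
  lam_nonneg : 0 ≤ p.lam
  contDiffAt_φ : ∀ x ∈ p.Ω, ∀ θ ∈ p.D, ContDiffAt ℝ 2 (fun a => p.φ a x) θ
  lipschitz_hess_φ : ∃ L : ℝ≥0, ∀ x ∈ p.Ω, LipschitzOnWith L (hess fun a => p.φ a x) p.D
  contDiffAt_r : ∀ θ ∈ p.D, ContDiffAt ℝ 2 p.r θ
  lipschitz_hess_r : LocallyLipschitzOn p.D (hess p.r)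

/-- The integral `∫ h dν̂` of `h` against the empirical data measure `ν̂ = n⁻¹ ∑ₗ δ_{xₗ}`. -/
def dataAvg (p : Problem k d n) (h : EuclideanSpace ℝ (Fin d) → ℝ) : ℝ :=
  (n : ℝ)⁻¹ * ∑ l, h (p.x l)

/-- `‖h‖²_ν̂`. -/
def dataSqNorm (p : Problem k d n) (h : EuclideanSpace ℝ (Fin d) → ℝ) : ℝ :=
  p.dataAvg fun x => h x ^ 2

/-- `f[μ](x) = ∫ φ(θ, x) μ(dθ)`. -/
def f (p : Problem k d n) (μ : Measure (EuclideanSpace ℝ (Fin k)))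
    (x : EuclideanSpace ℝ (Fin d)) : ℝ :=
  ∫ θ, p.φ θ x ∂μ

/-- `F(θ) = ∫ f_*(x) φ(θ, x) ν̂(dx) - lam r(θ)`. -/
def F (p : Problem k d n) (θ : EuclideanSpace ℝ (Fin k)) : ℝ :=
  p.dataAvg (fun x => p.fstar x * p.φ θ x) - p.lam * p.r θ

/-- `K(θ, θ') = ∫ φ(θ, x) φ(θ', x) ν̂(dx)`. -/
def K (p : Problem k d n) (θ θ' : EuclideanSpace ℝ (Fin k)) : ℝ :=
  p.dataAvg fun x => p.φ θ x * p.φ θ' x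

/-- The potential `V(θ, μ) = -F(θ) + ∫ K(θ, θ') μ(dθ')`. -/
def V (p : Problem k d n) (μ : Measure (EuclideanSpace ℝ (Fin k)))
    (θ : EuclideanSpace ℝ (Fin k)) : ℝ :=
  -p.F θ + ∫ θ', p.K θ θ' ∂μ

/-- `∇K(θ, θ')`, the gradient in the first variable. -/
def gradK (p : Problem k d n) (θ θ' : EuclideanSpace ℝ (Fin k)) : EuclideanSpace ℝ (Fin k) :=
  gradient (fun a => p.K a θ') θ

/-- `∇'∇K(θ, θ')`, as an operator: the derivative of `∇K(θ, θ')` in the variable `θ'`. -/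
def mixedHessK (p : Problem k d n) (θ θ' : EuclideanSpace ℝ (Fin k)) :
    EuclideanSpace ℝ (Fin k) →L[ℝ] EuclideanSpace ℝ (Fin k) :=
  fderiv ℝ (fun b => p.gradK θ b) θ'

/-- `Θ` is the characteristic flow of the mean-field gradient flow, started from `μ₀` and defined
for all times `t ≥ 0`: `Θ̇_t(θ) = -∇V(Θ_t(θ), μ_t)`, `Θ_0(θ) = θ`, where `μ_t` is the image of
`μ₀` under `Θ_t`. Only the points `θ` of the support of `μ₀` matter. -/
structure IsCharFlow (p : Problem k d n) (μ₀ : Measure (EuclideanSpace ℝ (Fin k)))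
    (Θ : ℝ → EuclideanSpace ℝ (Fin k) → EuclideanSpace ℝ (Fin k)) : Prop where
  initial : ∀ θ ∈ μ₀.support, Θ 0 θ = θ
  mem_D : ∀ t, 0 ≤ t → ∀ θ ∈ μ₀.support, Θ t θ ∈ p.D
  continuousOn : ContinuousOn (Function.uncurry Θ) (Ici 0 ×ˢ μ₀.support)
  ode : ∀ θ ∈ μ₀.support, ∀ t, 0 ≤ t →
    HasDerivWithinAt (fun s => Θ s θ) (-gradient (p.V (μ₀.map (Θ t))) (Θ t θ)) (Ici 0) t

end Problem

section Fluctuations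

variable {S : Type*} [MeasurableSpace S]

/-- `ω₀` is the Gaussian random measure (a Gaussian field on test functions) with mean zero and
covariance `𝔼[ω₀(dθ) ω₀(dθ')] = μ₀(dθ) δ_θ(dθ') - μ₀(dθ) μ₀(dθ')`; `ω₀ χ` is the random variable
`∫ χ dω₀`. -/
structure IsGaussianFluctuation (P : Measure S) (μ₀ : Measure (EuclideanSpace ℝ (Fin k)))
    (ω₀ : Lp ℝ 2 μ₀ →ₗ[ℝ] Lp ℝ 2 P) : Prop where
  gaussian : IsGaussianProcess (fun (χ : Lp ℝ 2 μ₀) (s : S) => ω₀ χ s) P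
  mean_zero : ∀ χ : Lp ℝ 2 μ₀, ∫ s, ω₀ χ s ∂P = 0
  covariance : ∀ χ ψ : Lp ℝ 2 μ₀,
    ∫ s, ω₀ χ s * ω₀ ψ s ∂P = (∫ θ, χ θ * ψ θ ∂μ₀) - (∫ θ, χ θ ∂μ₀) * ∫ θ, ψ θ ∂μ₀

variable {P : Measure S} {μ₀ : Measure (EuclideanSpace ℝ (Fin k))}

open Classical in
/-- The random variable `∫ χ(θ) ω₀(dθ)`, for a test function `χ` in `L²(μ₀)`. -/
def noiseInt (ω₀ : Lp ℝ 2 μ₀ →ₗ[ℝ] Lp ℝ 2 P) (χ : EuclideanSpace ℝ (Fin k) → ℝ) : Lp ℝ 2 P :=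
  if h : MemLp χ 2 μ₀ then ω₀ (h.toLp χ) else 0

/-- The random vector `∫ χ(θ) ω₀(dθ)`, for a vector-valued `χ`, coordinate by coordinate. -/
def noiseIntVec (ω₀ : Lp ℝ 2 μ₀ →ₗ[ℝ] Lp ℝ 2 P)
    (χ : EuclideanSpace ℝ (Fin k) → EuclideanSpace ℝ (Fin k)) :
    Lp (EuclideanSpace ℝ (Fin k)) 2 P :=
  ∑ i, (ContinuousLinearMap.toSpanSingleton ℝ (EuclideanSpace.single i (1 : ℝ))).compLp
    (noiseInt ω₀ fun θ => χ θ i)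

namespace Problem

/-- `T_t(θ)`, a square-integrable random vector for each `t` and `θ`, is the fluctuation of the
flow: `T_0 = 0` and
`Ṫ_t(θ) = -∇∇V(Θ_t(θ), μ_t) T_t(θ) - ∫ ∇'∇K(Θ_t(θ), Θ_t(θ')) T_t(θ') μ₀(dθ')`
`  - ∫ ∇K(Θ_t(θ), Θ_t(θ')) ω₀(dθ')`,
where the time derivative is taken in mean square. -/
structure IsFlowFluctuation [IsProbabilityMeasure P] (p : Problem k d n)
    (Θ : ℝ → EuclideanSpace ℝ (Fin k) → EuclideanSpace ℝ (Fin k))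
    (ω₀ : Lp ℝ 2 μ₀ →ₗ[ℝ] Lp ℝ 2 P)
    (T : ℝ → EuclideanSpace ℝ (Fin k) → Lp (EuclideanSpace ℝ (Fin k)) 2 P) : Prop where
  initial : ∀ θ ∈ μ₀.support, T 0 θ = 0
  continuousOn : ContinuousOn (Function.uncurry T) (Ici 0 ×ˢ μ₀.support)
  ode : ∀ θ ∈ μ₀.support, ∀ t, 0 ≤ t →
    HasDerivWithinAt (fun s => T s θ)
      (-(hess (p.V (μ₀.map (Θ t))) (Θ t θ)).compLp (T t θ)
        - ∫ θ', (p.mixedHessK (Θ t θ) (Θ t θ')).compLp (T t θ') ∂μ₀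
        - noiseIntVec ω₀ fun θ' => p.gradK (Θ t θ) (Θ t θ')) (Ici 0) t

/-- The limiting fluctuation of the represented function,
`g_t(x) = ∫ φ(Θ_t(θ), x) ω₀(dθ) + ∫ ∇φ(Θ_t(θ), x) · T_t(θ) μ₀(dθ)`. -/
def g (p : Problem k d n)
    (Θ : ℝ → EuclideanSpace ℝ (Fin k) → EuclideanSpace ℝ (Fin k))
    (ω₀ : Lp ℝ 2 μ₀ →ₗ[ℝ] Lp ℝ 2 P)
    (T : ℝ → EuclideanSpace ℝ (Fin k) → Lp (EuclideanSpace ℝ (Fin k)) 2 P)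
    (t : ℝ) (x : EuclideanSpace ℝ (Fin d)) : Lp ℝ 2 P :=
  noiseInt ω₀ (fun θ => p.φ (Θ t θ) x)
    + ∫ θ, (innerSL ℝ (gradient (fun a => p.φ a x) (Θ t θ))).compLp (T t θ) ∂μ₀

/-- `𝔼 ‖h‖²_ν̂` for a random function `h`. -/
def expSqNorm (p : Problem k d n) (h : EuclideanSpace ℝ (Fin d) → Lp ℝ 2 P) : ℝ≥0∞ :=
  (n : ℝ≥0∞)⁻¹ * ∑ l, ∫⁻ s, ‖h (p.x l) s‖ₑ ^ 2 ∂P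

/-- The Monte-Carlo resampling bound `∫ ‖φ(θ, ·)‖²_ν̂ μ(dθ) - ‖f[μ]‖²_ν̂`. -/
def monteCarloBound (p : Problem k d n) (μ : Measure (EuclideanSpace ℝ (Fin k))) : ℝ :=
  (∫ θ, p.dataSqNorm (p.φ θ) ∂μ) - p.dataSqNorm (p.f μ)

end Problem

end Fluctuations

section Conditions

/-- `∇∇V(θ, μ) ≻ σ Id` for all `θ` in the support of `μ`, for some `σ > 0`. -/
def Problem.CurvatureBound (p : Problem k d n) (μ : Measure (EuclideanSpace ℝ (Fin k))) : Prop :=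
  ∃ σ : ℝ, 0 < σ ∧ ∀ θ ∈ μ.support, ∀ v : EuclideanSpace ℝ (Fin k), v ≠ 0 →
    σ * ‖v‖ ^ 2 < inner ℝ v (hess (p.V μ) θ v)

variable (μ₀ : Measure (EuclideanSpace ℝ (Fin k)))
  (Θ : ℝ → EuclideanSpace ℝ (Fin k) → EuclideanSpace ℝ (Fin k))
  (Θinf : EuclideanSpace ℝ (Fin k) → EuclideanSpace ℝ (Fin k))

/-- `Θ_t → Θ_∞` uniformly on the support of `μ₀`, at rate `O(t^{-α})` with some `α > 3/2`. -/
def UniformRate : Prop :=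
  ∃ α : ℝ, 3 / 2 < α ∧ ∃ κ t₁ : ℝ, 0 < t₁ ∧
    ∀ t, t₁ ≤ t → ∀ θ ∈ μ₀.support, ‖Θ t θ - Θinf θ‖ ≤ κ * t ^ (-α)

/-- The set `D'` of all positions visited by the flow. -/
def trajectories : Set (EuclideanSpace ℝ (Fin k)) :=
  {a | ∃ t : ℝ, 0 ≤ t ∧ ∃ θ ∈ μ₀.support, Θ t θ = a}

/-- `U_t(θ) = ∫_t^∞ |Θ_s(θ) - Θ_∞(θ)| ds`. -/
def U (t : ℝ) (θ : EuclideanSpace ℝ (Fin k)) : ℝ≥0∞ :=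
  ∫⁻ s in Ioi t, ‖Θ s θ - Θinf θ‖ₑ

/-- `Ū_t = ∫ U_t(θ) μ₀(dθ)`. -/
def Ubar (t : ℝ) : ℝ≥0∞ := ∫⁻ θ, U Θ Θinf t θ ∂μ₀

/-- `∫₀^∞ ∫ (|Θ_t(θ) - Θ_∞(θ)| + U_t(θ)²) e^{C₁ (U_t(θ) + Ū_t)} μ₀(dθ) dt < ∞`. -/
def WeightedIntegrability (C₁ : ℝ) : Prop :=
  ∫⁻ t in Ioi (0 : ℝ), ∫⁻ θ, (‖Θ t θ - Θinf θ‖ₑ + U Θ Θinf t θ ^ 2) *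
    EReal.exp ((C₁ : EReal) * ((U Θ Θinf t θ + Ubar μ₀ Θ Θinf t : ℝ≥0∞) : EReal)) ∂μ₀ < ⊤

/-- `D'` is relatively compact in `D`, and `M` bounds, over `D'` and the data points, the sizes
and the Lipschitz constants of `φ`, `∇φ` and `∇∇φ`, the size of `f_*`, and the Lipschitz constant
of `lam ∇∇r`. -/
structure Problem.BoundedBy (p : Problem k d n) (D' : Set (EuclideanSpace ℝ (Fin k)))
    (M : ℝ) : Prop where
  isCompact_closure : IsCompact (closure D')
  closure_subset : closure D' ⊆ p.D
  fstar_le : ∀ l, |p.fstar (p.x l)| ≤ M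
  φ_le : ∀ l, ∀ a ∈ D', |p.φ a (p.x l)| ≤ M
  grad_le : ∀ l, ∀ a ∈ D', ‖gradient (fun c => p.φ c (p.x l)) a‖ ≤ M
  hess_le : ∀ l, ∀ a ∈ D', ‖hess (fun c => p.φ c (p.x l)) a‖ ≤ M
  φ_lip : ∀ l, ∀ a ∈ D', ∀ b ∈ D', |p.φ a (p.x l) - p.φ b (p.x l)| ≤ M * ‖a - b‖
  grad_lip : ∀ l, ∀ a ∈ D', ∀ b ∈ D',
    ‖gradient (fun c => p.φ c (p.x l)) a - gradient (fun c => p.φ c (p.x l)) b‖ ≤ M * ‖a - b‖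
  hess_lip : ∀ l, ∀ a ∈ D', ∀ b ∈ D',
    ‖hess (fun c => p.φ c (p.x l)) a - hess (fun c => p.φ c (p.x l)) b‖ ≤ M * ‖a - b‖
  reg_lip : ∀ a ∈ D', ∀ b ∈ D', ‖p.lam • (hess p.r a - hess p.r b)‖ ≤ M * ‖a - b‖

end Conditions

end MeanFieldERM

end

universe u

/-!
The proof is an energy argument for the linearized flow, carried out in the Hilbert space `L²(P)`.

Since the kernel is `K(θ, θ') = ∫ φ(θ, x) φ(θ', x) ν̂(dx)`, the interaction and noise terms of the
equation for `T_t` add up to the force `b_t(θ) = ∫ ∇φ(Θ_t(θ), x) g_t(x) ν̂(dx)`, so that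
`Ṫ_t(θ) = -A_t(θ) T_t(θ) - b_t(θ)` with `A_t(θ) = ∇∇V(Θ_t(θ), μ_t)`
(`interaction_add_noise_eq_forcing`). Conversely, `g_t = ḡ_t + ∫ ∇φ(Θ_t(θ), ·) · T_t(θ) μ₀(dθ)` with
the Monte-Carlo part `ḡ_t = ∫ φ(Θ_t(θ), ·) ω₀(dθ)`. The two maps are adjoint, whence
`∫ 𝔼⟪T_t, b_t⟫ dμ₀ = 𝔼⟪g_t - ḡ_t, g_t⟫_ν̂` (`integral_inner_forcing`). If `A_t ≥ 0`, differentiating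
`‖T_t‖²` yields `∫ 𝔼⟪g_t - ḡ_t, g_t⟫ dt ≤ 0` for fluctuations starting from zero, and hence
`∫ 𝔼‖g_t‖² dt ≤ ∫ 𝔼‖ḡ_t‖² dt`. The variance `𝔼‖ḡ_t‖²` converges to the Monte-Carlo bound for `μ_∞`
(`tendsto_norm_sq_sampling`); of `ω₀`, only the covariance matters.

In general `A_t(θ) ≥ σ - δ_t(θ)` with a defect `δ_t(θ)` proportional to
`|Θ_t(θ) - Θ_∞(θ)| + ∫ |Θ_t - Θ_∞| dμ₀` (`curvature_along_flow`). The defect is absorbed, separately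
for each `θ`, by the decreasing weight `exp (2 ∫_t^∞ δ_s(θ) ds)` on `‖T_t(θ)‖²`
(`integral_inner_forcing_le`). From a time `a` on, the price is the initial energy at time `a`, which
disappears in the long-time average, and a term `ε_a ∫ 𝔼‖g_t‖² dt`, where `ε_a` is proportional to
`∫ (e^{2 D_a(θ)} - 1) μ₀(dθ)` and `D_a(θ)` bounds `∫_a^∞ δ_s(θ) ds`. By dominated convergence
`ε_a → 0` as soon as some `e^{2 D_a}` is `μ₀`-integrable (`tendsto_integral_exp_totalDefect`), and
either rate condition provides this (`exists_convergesIn`). The constant is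
`C₁(M) = 2 (1 + |M| + 2 M²)`.
-/

noncomputable section

namespace MeanFieldERM

/-! ### An energy inequality for a linear equation in a Hilbert space -/

lemma hasDerivAt_integral_of_continuousOn_Ici {h : ℝ → ℝ} (hh : ContinuousOn h (Ici 0))
    {a t : ℝ} (ha : 0 ≤ a) (ht : a < t) :
    HasDerivAt (fun u => ∫ s in a..u, h s) (h t) t := by
  have hpos : 0 < t := lt_of_le_of_lt ha ht
  have hcont : ∀ᶠ s in 𝓝 t, ContinuousAt h s := by
    filter_upwards [Ioi_mem_nhds hpos] with s hs
    exact (hh s (mem_Ici.2 (le_of_lt hs))).continuousAt (Ici_mem_nhds hs)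
  refine intervalIntegral.integral_hasDerivAt_right ?_ ?_ hcont.self_of_nhds
  · refine (hh.mono ?_).intervalIntegrable
    intro s hs
    rw [uIcc_of_le ht.le] at hs
    exact ha.trans hs.1
  · exact ContinuousOn.stronglyMeasurableAtFilter_nhdsWithin (hh.mono Ioi_subset_Ici_self)
      measurableSet_Ioi t |>.filter_mono (by
        rw [nhdsWithin_eq_nhds.2 (Ioi_mem_nhds hpos)])

lemma continuousOn_integral_of_continuousOn_Ici {h : ℝ → ℝ} (hh : ContinuousOn h (Ici 0))
    {a τ : ℝ} (ha : 0 ≤ a) (hτ : a ≤ τ) :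
    ContinuousOn (fun u => ∫ s in a..u, h s) (Icc a τ) := by
  have := intervalIntegral.continuousOn_primitive_interval (a := a) (b := τ) (f := h) (μ := volume)
    ((hh.mono (by
      intro s hs
      rw [uIcc_of_le hτ] at hs
      exact ha.trans hs.1)).integrableOn_compact isCompact_uIcc)
  rwa [uIcc_of_le hτ] at this

/-- Energy inequality for `T' = -A T - b` where `A ≥ σ - δ_t` and the total defect `∫ δ` is at
most `D₀`: up to a fraction `e^{2 D₀} - 1` of the squared forcing, the work `∫ ⟪T, b⟫` done by the
forcing is bounded by the initial energy. The energy is weighted by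
`exp (2 (D₀ - ∫ δ))`, whose decay absorbs the defect of positivity. -/
lemma integral_inner_forcing_le {X : Type*} [NormedAddCommGroup X] [InnerProductSpace ℝ X]
    {T T' b : ℝ → X} {G δ : ℝ → ℝ} {a τ σ m D₀ : ℝ} (ha : 0 ≤ a) (hτ : a ≤ τ) (hσ : 0 < σ)
    (hT : ∀ t, 0 ≤ t → HasDerivWithinAt T (T' t) (Ici 0) t)
    (hb : ContinuousOn b (Ici 0)) (hG : ContinuousOn G (Ici 0)) (hδ : ContinuousOn δ (Ici 0))
    (hbG : ∀ t, 0 ≤ t → ‖b t‖ ^ 2 ≤ m * G t) (hδ0 : ∀ t, 0 ≤ δ t)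
    (hD : ∀ t, a ≤ t → ∫ s in a..t, δ s ≤ D₀)
    (hA : ∀ t, a ≤ t → inner ℝ (T t) (T' t + b t) ≤ -(σ - δ t) * ‖T t‖ ^ 2) :
    ∫ t in a..τ, inner ℝ (T t) (b t) ≤
      2⁻¹ * Real.exp (2 * D₀) * ‖T a‖ ^ 2
        + (Real.exp (2 * D₀) - 1) * (m / (4 * σ)) * ∫ t in a..τ, G t := by
  have hTc : ContinuousOn T (Ici 0) := fun t ht => (hT t ht).continuousWithinAt
  have hIcc : Icc a τ ⊆ Ici 0 := fun s hs => ha.trans hs.1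
  have hTb : ContinuousOn (fun t => inner ℝ (T t) (b t)) (Ici 0) := hTc.inner hb
  set c : ℝ := (Real.exp (2 * D₀) - 1) * (m / (4 * σ)) with hc
  set J : ℝ → ℝ := fun t => Real.exp (2 * (D₀ - ∫ s in a..t, δ s)) with hJ
  set Φ : ℝ → ℝ := fun t => 2⁻¹ * (J t * ‖T t‖ ^ 2) + (∫ s in a..t, inner ℝ (T s) (b s))
    - c * ∫ s in a..t, G s with hΦ
  -- `Φ` is the weighted energy plus the work, less the allowance for the squared forcing
  have hanti : AntitoneOn Φ (Icc a τ) := by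
    refine antitoneOn_of_hasDerivWithinAt_nonpos (convex_Icc a τ)
      (f' := fun t => 2⁻¹ * ((J t * (2 * (-δ t))) * ‖T t‖ ^ 2 + J t * (2 * inner ℝ (T t) (T' t)))
        + inner ℝ (T t) (b t) - c * G t) ?_ ?_ ?_
    · refine ContinuousOn.sub (ContinuousOn.add ?_ ?_) ?_
      · refine continuousOn_const.mul (ContinuousOn.mul ?_ ((hTc.mono hIcc).norm.pow 2))
        exact Real.continuous_exp.comp_continuousOn (continuousOn_const.mul
          (continuousOn_const.sub (continuousOn_integral_of_continuousOn_Ici hδ ha hτ)))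
      · exact continuousOn_integral_of_continuousOn_Ici hTb ha hτ
      · exact continuousOn_const.mul (continuousOn_integral_of_continuousOn_Ici hG ha hτ)
    · intro t ht
      rw [interior_Icc] at ht
      have hpos : 0 < t := lt_of_le_of_lt ha ht.1
      have hTt : HasDerivAt T (T' t) t := (hT t hpos.le).hasDerivAt (Ici_mem_nhds hpos)
      refine HasDerivAt.hasDerivWithinAt ?_
      refine HasDerivAt.sub (HasDerivAt.add ?_ ?_) ?_
      · refine HasDerivAt.const_mul _ (HasDerivAt.mul ?_ hTt.norm_sq)
        exact (((hasDerivAt_integral_of_continuousOn_Ici hδ ha ht.1).const_sub D₀).const_mul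
          2).exp
      · exact hasDerivAt_integral_of_continuousOn_Ici hTb ha ht.1
      · exact (hasDerivAt_integral_of_continuousOn_Ici hG ha ht.1).const_mul c
    · intro t ht
      rw [interior_Icc] at ht
      have hpos : 0 < t := lt_of_le_of_lt ha ht.1
      have hA' := hA t ht.1.le
      rw [inner_add_right] at hA'
      have hJ1 : 1 ≤ J t := Real.one_le_exp (by linarith [hD t ht.1.le])
      have hJ2 : J t ≤ Real.exp (2 * D₀) := by
        refine Real.exp_le_exp.2 ?_
        have := intervalIntegral.integral_nonneg (μ := volume) ht.1.le (fun s _ => hδ0 s)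
        linarith
      -- Young's inequality, with the weight for which the share of `‖T‖²` is absorbed by `σ`
      have hyoung : -inner ℝ (T t) (b t) ≤ σ * ‖T t‖ ^ 2 + m / (4 * σ) * G t := by
        have h1 : -inner ℝ (T t) (b t) ≤ ‖T t‖ * ‖b t‖ :=
          (neg_le_abs _).trans (abs_real_inner_le_norm _ _)
        have h2 : ‖T t‖ * ‖b t‖ ≤ σ * ‖T t‖ ^ 2 + ‖b t‖ ^ 2 / (4 * σ) := by
          have h3 : σ * ‖T t‖ ^ 2 + ‖b t‖ ^ 2 / (4 * σ) - ‖T t‖ * ‖b t‖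
              = (2 * σ * ‖T t‖ - ‖b t‖) ^ 2 / (4 * σ) := by field_simp; ring
          have h4 : 0 ≤ (2 * σ * ‖T t‖ - ‖b t‖) ^ 2 / (4 * σ) := by positivity
          linarith
        have h5 : ‖b t‖ ^ 2 / (4 * σ) ≤ m * G t / (4 * σ) := by
          have := hbG t hpos.le
          gcongr
        have h6 : m * G t / (4 * σ) = m / (4 * σ) * G t := by ring
        linarith
      have hmG : 0 ≤ m / (4 * σ) * G t := by
        have : 0 ≤ m * G t := (sq_nonneg _).trans (hbG t hpos.le)
        have h6 : m * G t / (4 * σ) = m / (4 * σ) * G t := by ring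
        rw [← h6]; positivity
      have e1 : J t * inner ℝ (T t) (T' t)
          ≤ J t * (-(σ - δ t) * ‖T t‖ ^ 2 - inner ℝ (T t) (b t)) :=
        mul_le_mul_of_nonneg_left (by linarith) (by linarith)
      have e2 : (J t - 1) * (-inner ℝ (T t) (b t))
          ≤ (J t - 1) * (σ * ‖T t‖ ^ 2 + m / (4 * σ) * G t) :=
        mul_le_mul_of_nonneg_left hyoung (by linarith)
      have e3 : (J t - 1) * (m / (4 * σ) * G t) ≤ c * G t := by
        have := mul_le_mul_of_nonneg_right (sub_le_sub_right hJ2 1) hmG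
        rw [hc]; linarith
      have e4 : 0 ≤ σ * ‖T t‖ ^ 2 := by positivity
      linarith
  have hfin := hanti (left_mem_Icc.2 hτ) (right_mem_Icc.2 hτ) hτ
  simp only [hΦ, hJ, intervalIntegral.integral_same, sub_zero, mul_zero, add_zero] at hfin
  have : 0 ≤ 2⁻¹ * (Real.exp (2 * (D₀ - ∫ s in a..τ, δ s)) * ‖T τ‖ ^ 2) := by positivity
  linarith

/-! ### Operators acting on square-integrable random vectors -/

section Lp

variable {S : Type*} [MeasurableSpace S] {P : Measure S}
  {X Y : Type*} [NormedAddCommGroup X] [InnerProductSpace ℝ X]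
  [NormedAddCommGroup Y] [InnerProductSpace ℝ Y]

lemma ContinuousOn.compLp {Z : Type*} [TopologicalSpace Z] {s : Set Z} {L : Z → X →L[ℝ] Y}
    {h : Z → Lp X 2 P} (hL : ContinuousOn L s) (hh : ContinuousOn h s) :
    ContinuousOn (fun z => (L z).compLp (h z)) s := by
  have := ((ContinuousLinearMap.compLpL₂ 2 P
    (ContinuousLinearMap.id ℝ (X →L[ℝ] Y))).continuous.comp_continuousOn hL).clm_apply hh
  simpa using this

lemma sum_compLp {ι : Type*} (s : Finset ι) (L : ι → X →L[ℝ] Y) (h : Lp X 2 P) :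
    (∑ i ∈ s, L i).compLp h = ∑ i ∈ s, (L i).compLp h := by
  classical
  have := congrArg (fun F => F h)
    (map_sum (ContinuousLinearMap.compLpL₂ 2 P (ContinuousLinearMap.id ℝ (X →L[ℝ] Y))) L s)
  simpa only [sum_apply, ContinuousLinearMap.compLpL₂_apply_apply,
    ContinuousLinearMap.id_apply] using this

lemma comp_compLp {Z : Type*} [NormedAddCommGroup Z] [NormedSpace ℝ Z] (L : Y →L[ℝ] Z)
    (L' : X →L[ℝ] Y) (h : Lp X 2 P) : (L.comp L').compLp h = L.compLp (L'.compLp h) := by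
  apply Lp.ext
  filter_upwards [L.coeFn_compLp (L'.compLp h), L'.coeFn_compLp h, (L.comp L').coeFn_compLp h]
    with s h1 h2 h3
  rw [h1, h2, h3]; rfl

/-- Multiplication of a random scalar by a vector `v` is adjoint to the scalar product with `v`. -/
lemma inner_toSpanSingleton_compLp (v : X) (h : Lp X 2 P) (q : Lp ℝ 2 P) :
    inner ℝ h ((ContinuousLinearMap.toSpanSingleton ℝ v).compLp q)
      = inner ℝ ((innerSL ℝ v).compLp h) q := by
  rw [L2.inner_def, L2.inner_def]
  refine integral_congr_ae ?_
  filter_upwards [(ContinuousLinearMap.toSpanSingleton ℝ v).coeFn_compLp q,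
    (innerSL ℝ v).coeFn_compLp h] with s h1 h2
  rw [h1, h2]
  simp [inner_smul_right, real_inner_comm]

lemma mul_norm_sq_le_inner_compLp {L : X →L[ℝ] X} {c : ℝ}
    (hL : ∀ v, c * ‖v‖ ^ 2 ≤ inner ℝ v (L v)) (h : Lp X 2 P) :
    c * ‖h‖ ^ 2 ≤ inner ℝ h (L.compLp h) := by
  rw [← real_inner_self_eq_norm_sq, L2.inner_def, L2.inner_def, ← integral_const_mul]
  refine integral_mono_ae ((L2.integrable_inner h h).const_mul c)
    (L2.integrable_inner h (L.compLp h)) ?_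
  filter_upwards [L.coeFn_compLp h] with s hs
  rw [hs, real_inner_self_eq_norm_sq]
  exact hL _

end Lp

/-! ### Integrals of continuous families over a compact set of full measure -/

section Compact

variable {k : ℕ} {μ : Measure (EuclideanSpace ℝ (Fin k))} {K : Set (EuclideanSpace ℝ (Fin k))}
  {Y : Type*} [NormedAddCommGroup Y]

lemma restrict_eq_self_of_mem_ae (hK : K ∈ ae μ) : μ.restrict K = μ :=
  Measure.restrict_eq_self_of_ae_mem hK

lemma integrable_of_continuousOn_compact [IsFiniteMeasure μ] (hKc : IsCompact K) (hK : K ∈ ae μ)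
    {h : EuclideanSpace ℝ (Fin k) → Y} (hh : ContinuousOn h K) : Integrable h μ := by
  have := hh.integrableOn_compact (μ := μ) hKc
  rwa [IntegrableOn, restrict_eq_self_of_mem_ae hK] at this

lemma continuousOn_slice {h : ℝ → EuclideanSpace ℝ (Fin k) → Y}
    (hh : ContinuousOn (Function.uncurry h) (Ici 0 ×ˢ K)) {t : ℝ} (ht : 0 ≤ t) :
    ContinuousOn (h t) K :=
  hh.comp (f := fun θ => (t, θ)) (by fun_prop) fun _ hθ => ⟨ht, hθ⟩

lemma continuousOn_slice_time {h : ℝ → EuclideanSpace ℝ (Fin k) → Y}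
    (hh : ContinuousOn (Function.uncurry h) (Ici 0 ×ˢ K)) {θ : EuclideanSpace ℝ (Fin k)}
    (hθ : θ ∈ K) : ContinuousOn (fun t => h t θ) (Ici 0) :=
  hh.comp (f := fun t => (t, θ)) (by fun_prop) fun _ ht => ⟨ht, hθ⟩

lemma continuousOn_integral_of_compact [NormedSpace ℝ Y] [IsFiniteMeasure μ]
    (hKc : IsCompact K) (hK : K ∈ ae μ) {h : ℝ → EuclideanSpace ℝ (Fin k) → Y}
    (hh : ContinuousOn (Function.uncurry h) (Ici 0 ×ˢ K)) :
    ContinuousOn (fun t => ∫ θ, h t θ ∂μ) (Ici 0) := by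
  intro t ht
  obtain ⟨C, hC⟩ := (isCompact_Icc (a := (0 : ℝ)) (b := t + 1)).prod hKc
    |>.exists_bound_of_continuousOn (hh.mono (prod_mono (fun s hs => hs.1) le_rfl))
  refine continuousWithinAt_of_dominated (bound := fun _ => C) ?_ ?_ (integrable_const _) ?_
  · filter_upwards [self_mem_nhdsWithin] with s hs
    exact (integrable_of_continuousOn_compact hKc hK (continuousOn_slice hh hs)).1
  · filter_upwards [self_mem_nhdsWithin,
      mem_nhdsWithin_of_mem_nhds (Iic_mem_nhds (lt_add_one t))] with s hs hs'
    filter_upwards [hK] with θ hθ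
    exact hC (s, θ) ⟨⟨hs, hs'⟩, hθ⟩
  · filter_upwards [hK] with θ hθ
    exact continuousOn_slice_time hh hθ t ht

lemma integral_intervalIntegral_swap_of_compact [IsFiniteMeasure μ]
    (hKc : IsCompact K) (hK : K ∈ ae μ) {h : ℝ → EuclideanSpace ℝ (Fin k) → ℝ}
    (hh : ContinuousOn (Function.uncurry h) (Ici 0 ×ˢ K)) {a τ : ℝ} (ha : 0 ≤ a) (hτ : a ≤ τ) :
    Integrable (fun θ => ∫ t in a..τ, h t θ) μ ∧
      ∫ t in a..τ, (∫ θ, h t θ ∂μ) = ∫ θ, (∫ t in a..τ, h t θ) ∂μ := by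
  have hint : Integrable (Function.uncurry h) ((volume.restrict (Set.uIoc a τ)).prod μ) := by
    have h1 : IntegrableOn (Function.uncurry h) (Icc a τ ×ˢ K) (volume.prod μ) :=
      (hh.mono (prod_mono (fun s hs => ha.trans hs.1) le_rfl)).integrableOn_compact
        (isCompact_Icc.prod hKc)
    rw [IntegrableOn, ← Measure.prod_restrict, restrict_eq_self_of_mem_ae hK] at h1
    rw [uIoc_of_le hτ]
    exact h1.mono_measure (Measure.prod_mono (Measure.restrict_mono Ioc_subset_Icc_self le_rfl)
      le_rfl)
  refine ⟨?_, intervalIntegral_integral_swap hint⟩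
  have := hint.integral_prod_right
  simpa [intervalIntegral.integral_of_le hτ, uIoc_of_le hτ] using this

end Compact

/-! ### Integrals against the Gaussian random measure -/

section Noise

variable {k : ℕ} {S : Type*} [MeasurableSpace S] {P : Measure S}
  {μ₀ : Measure (EuclideanSpace ℝ (Fin k))} {ω₀ : Lp ℝ 2 μ₀ →ₗ[ℝ] Lp ℝ 2 P}

lemma noiseInt_of_memLp {χ : EuclideanSpace ℝ (Fin k) → ℝ} (h : MemLp χ 2 μ₀) :
    noiseInt ω₀ χ = ω₀ (h.toLp χ) := dif_pos h

/-- The variance of `∫ χ dω₀` is that of `χ` under `μ₀`. -/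
lemma norm_sq_noiseInt (hω : IsGaussianFluctuation P μ₀ ω₀)
    {χ : EuclideanSpace ℝ (Fin k) → ℝ} (h : MemLp χ 2 μ₀) :
    ‖noiseInt ω₀ χ‖ ^ 2 = (∫ θ, χ θ ^ 2 ∂μ₀) - (∫ θ, χ θ ∂μ₀) ^ 2 := by
  rw [noiseInt_of_memLp h, ← real_inner_self_eq_norm_sq, L2.inner_def]
  have := hω.covariance (h.toLp χ) (h.toLp χ)
  simp only [RCLike.inner_apply, conj_trivial]
  rw [this, integral_congr_ae h.coeFn_toLp, sq (∫ θ, χ θ ∂μ₀)]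
  congr 1
  refine integral_congr_ae ?_
  filter_upwards [h.coeFn_toLp] with θ hθ
  rw [hθ, sq]

lemma noiseInt_sum {ι : Type*} (s : Finset ι) (c : ι → ℝ)
    {χ : ι → EuclideanSpace ℝ (Fin k) → ℝ} (h : ∀ i, MemLp (χ i) 2 μ₀) :
    noiseInt ω₀ (fun θ => ∑ i ∈ s, c i * χ i θ) = ∑ i ∈ s, c i • noiseInt ω₀ (χ i) := by
  have hm : MemLp (fun θ => ∑ i ∈ s, c i * χ i θ) 2 μ₀ :=
    memLp_finsetSum s fun i _ => (h i).const_mul (c i)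
  rw [noiseInt_of_memLp hm]
  simp_rw [fun i => noiseInt_of_memLp (ω₀ := ω₀) (h i), ← map_smul, ← map_sum]
  congr 1
  classical
  induction s using Finset.induction_on with
  | empty => simp only [Finset.sum_empty]; exact MemLp.toLp_zero _
  | insert j s hj ih =>
    have hm' : MemLp (fun θ => ∑ i ∈ s, c i * χ i θ) 2 μ₀ :=
      memLp_finsetSum s fun i _ => (h i).const_mul (c i)
    rw [Finset.sum_insert hj, ← ih hm', ← MemLp.toLp_const_smul, ← MemLp.toLp_add]
    refine MemLp.toLp_congr _ _ (ae_of_all _ fun θ => ?_)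
    simp [Finset.sum_insert hj]

lemma noiseInt_sub {χ ψ : EuclideanSpace ℝ (Fin k) → ℝ} (h : MemLp χ 2 μ₀) (h' : MemLp ψ 2 μ₀) :
    noiseInt ω₀ χ - noiseInt ω₀ ψ = noiseInt ω₀ (χ - ψ) := by
  rw [noiseInt_of_memLp h, noiseInt_of_memLp h', noiseInt_of_memLp (h.sub h'), ← map_sub,
    MemLp.toLp_sub]

lemma noiseIntVec_sum {ι : Type*} (s : Finset ι) (v : ι → EuclideanSpace ℝ (Fin k))
    {χ : ι → EuclideanSpace ℝ (Fin k) → ℝ} (h : ∀ i, MemLp (χ i) 2 μ₀) :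
    noiseIntVec ω₀ (fun θ => ∑ i ∈ s, χ i θ • v i)
      = ∑ i ∈ s, (ContinuousLinearMap.toSpanSingleton ℝ (v i)).compLp (noiseInt ω₀ (χ i)) := by
  have h1 : ∀ j, noiseInt ω₀ (fun θ => (∑ i ∈ s, χ i θ • v i) j)
      = ∑ i ∈ s, v i j • noiseInt ω₀ (χ i) := by
    intro j
    rw [← noiseInt_sum s (fun i => v i j) h]
    congr 1
    ext θ
    simp [mul_comm]
  have h2 : ∀ i, ContinuousLinearMap.toSpanSingleton ℝ (v i)
      = ∑ j, v i j • ContinuousLinearMap.toSpanSingleton ℝ (EuclideanSpace.single j (1 : ℝ)) := by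
    intro i
    ext j
    simp [Pi.single_apply]
  simp only [noiseIntVec, h1, h2, sum_compLp, ContinuousLinearMap.smul_compLp]
  rw [Finset.sum_comm]
  refine Finset.sum_congr rfl fun j _ => ?_
  have := map_sum (ContinuousLinearMap.compLpL 2 P (ContinuousLinearMap.toSpanSingleton ℝ
    (EuclideanSpace.single j (1 : ℝ)))) (fun i => v i j • noiseInt ω₀ (χ i)) s
  simp only [map_smul] at this
  exact this

lemma continuousOn_noiseInt [IsFiniteMeasure μ₀] (hω : IsGaussianFluctuation P μ₀ ω₀)
    {K : Set (EuclideanSpace ℝ (Fin k))} (hKc : IsCompact K) (hK : K ∈ ae μ₀)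
    {χ : ℝ → EuclideanSpace ℝ (Fin k) → ℝ}
    (hχ : ContinuousOn (Function.uncurry χ) (Ici 0 ×ˢ K)) :
    ContinuousOn (fun t => noiseInt ω₀ (χ t)) (Ici 0) := by
  have hm : ∀ t, 0 ≤ t → MemLp (χ t) 2 μ₀ := fun t ht => by
    refine (memLp_two_iff_integrable_sq
      (integrable_of_continuousOn_compact hKc hK (continuousOn_slice hχ ht)).1).2 ?_
    exact integrable_of_continuousOn_compact hKc hK ((continuousOn_slice hχ ht).pow 2)
  intro t ht
  have h1 : ContinuousOn (fun s => ∫ θ, (χ s θ - χ t θ) ^ 2 ∂μ₀) (Ici 0) := by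
    refine continuousOn_integral_of_compact hKc hK (h := fun s θ => (χ s θ - χ t θ) ^ 2) ?_
    refine (hχ.sub ?_).pow 2
    exact (continuousOn_slice hχ ht).comp continuousOn_snd fun z hz => hz.2
  have h2 := (h1 t ht).tendsto
  simp only [sub_self, ne_eq, OfNat.ofNat_ne_zero, not_false_eq_true, zero_pow,
    integral_zero] at h2
  rw [ContinuousWithinAt, tendsto_iff_norm_sub_tendsto_zero]
  have h3 : Tendsto (fun s => √(∫ θ, (χ s θ - χ t θ) ^ 2 ∂μ₀)) (𝓝[Ici 0] t) (𝓝 0) := by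
    simpa [Function.comp_def] using (Real.continuous_sqrt.tendsto 0).comp h2
  refine squeeze_zero' (Eventually.of_forall fun _ => norm_nonneg _) ?_ h3
  filter_upwards [self_mem_nhdsWithin] with s hs
  refine Real.le_sqrt_of_sq_le ?_
  rw [noiseInt_sub (hm s hs) (hm t ht), norm_sq_noiseInt hω ((hm s hs).sub (hm t ht))]
  have : 0 ≤ (∫ θ, (χ s - χ t) θ ∂μ₀) ^ 2 := sq_nonneg _
  simp only [Pi.sub_apply] at this ⊢
  linarith

end Noise

/-! ### Gradients and Hessians of the activation, the kernel and the potential -/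

section Calculus

variable {k : ℕ} {f : EuclideanSpace ℝ (Fin k) → ℝ} {θ : EuclideanSpace ℝ (Fin k)}

lemma contDiffAt_gradient (h : ContDiffAt ℝ 2 f θ) : ContDiffAt ℝ 1 (gradient f) θ := by
  have h1 : ContDiffAt ℝ 1 (fderiv ℝ f) θ := h.fderiv_right (by norm_num)
  exact ((InnerProductSpace.toDual ℝ _).symm.toContinuousLinearEquiv.contDiff.contDiffAt).comp θ h1

lemma continuousAt_hess (h : ContDiffAt ℝ 2 f θ) : ContinuousAt (hess f) θ :=
  ((contDiffAt_gradient h).fderiv_right (m := 0) (by norm_num)).continuousAt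

lemma gradient_mul_add_sum {ι : Type*} [Fintype ι] {c₀ : ℝ} {c : ι → ℝ}
    {g : ι → EuclideanSpace ℝ (Fin k) → ℝ} (hf : DifferentiableAt ℝ f θ)
    (hg : ∀ i, DifferentiableAt ℝ (g i) θ) :
    gradient (fun a => c₀ * f a + ∑ i, c i * g i a) θ
      = c₀ • gradient f θ + ∑ i, c i • gradient (g i) θ := by
  have h : HasFDerivAt (fun a => c₀ * f a + ∑ i, c i * g i a)
      (c₀ • fderiv ℝ f θ + ∑ i, c i • fderiv ℝ (g i) θ) θ :=
    (hf.hasFDerivAt.const_mul c₀).add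
      (HasFDerivAt.fun_sum fun i _ => (hg i).hasFDerivAt.const_mul (c i))
  simp only [gradient, h.fderiv, map_add, map_sum, map_smulₛₗ]
  simp

/-- Unlike the gradient, the Hessian is linear only where the functions are differentiable in a
neighbourhood, which `C²` at the point provides. -/
lemma hess_mul_add_sum {ι : Type*} [Fintype ι] {c₀ : ℝ} {c : ι → ℝ}
    {g : ι → EuclideanSpace ℝ (Fin k) → ℝ} (hf : ContDiffAt ℝ 2 f θ)
    (hg : ∀ i, ContDiffAt ℝ 2 (g i) θ) :
    hess (fun a => c₀ * f a + ∑ i, c i * g i a) θ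
      = c₀ • hess f θ + ∑ i, c i • hess (g i) θ := by
  have hev : gradient (fun a => c₀ * f a + ∑ i, c i * g i a)
      =ᶠ[𝓝 θ] fun a => c₀ • gradient f a + ∑ i, c i • gradient (g i) a := by
    filter_upwards [hf.eventually (by simp),
      eventually_all.2 fun i => (hg i).eventually (by simp)] with a ha ha'
    exact gradient_mul_add_sum (ha.differentiableAt (by norm_num))
      fun i => (ha' i).differentiableAt (by norm_num)
  have h : HasFDerivAt (fun a => c₀ • gradient f a + ∑ i, c i • gradient (g i) a)
      (c₀ • hess f θ + ∑ i, c i • hess (g i) θ) θ :=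
    (((contDiffAt_gradient hf).differentiableAt (by norm_num)).hasFDerivAt.const_smul c₀).add
      (HasFDerivAt.fun_sum fun i _ =>
        ((contDiffAt_gradient (hg i)).differentiableAt (by norm_num)).hasFDerivAt.const_smul (c i))
  rw [hess, hev.fderiv_eq, h.fderiv]

end Calculus

namespace Problem

variable {k d n : ℕ} {p : Problem k d n}

/-- The gradient of the activation at the `l`-th data point. -/
abbrev gradφ (p : Problem k d n) (l : Fin n) (θ : EuclideanSpace ℝ (Fin k)) :
    EuclideanSpace ℝ (Fin k) :=
  gradient (fun a => p.φ a (p.x l)) θ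

namespace Regular

lemma continuousAt_φ (hp : p.Regular) (l : Fin n) {θ : EuclideanSpace ℝ (Fin k)} (hθ : θ ∈ p.D) :
    ContinuousAt (fun a => p.φ a (p.x l)) θ :=
  (hp.contDiffAt_φ _ (hp.x_mem l) θ hθ).continuousAt

lemma continuousAt_gradφ (hp : p.Regular) (l : Fin n) {θ : EuclideanSpace ℝ (Fin k)}
    (hθ : θ ∈ p.D) : ContinuousAt (p.gradφ l) θ :=
  (contDiffAt_gradient (hp.contDiffAt_φ _ (hp.x_mem l) θ hθ)).continuousAt

lemma continuousAt_hessφ (hp : p.Regular) (l : Fin n) {θ : EuclideanSpace ℝ (Fin k)}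
    (hθ : θ ∈ p.D) : ContinuousAt (hess fun a => p.φ a (p.x l)) θ :=
  continuousAt_hess (hp.contDiffAt_φ _ (hp.x_mem l) θ hθ)

lemma gradK_eq (hp : p.Regular) {θ : EuclideanSpace ℝ (Fin k)} (hθ : θ ∈ p.D)
    (θ' : EuclideanSpace ℝ (Fin k)) :
    p.gradK θ θ' = ∑ l, ((n : ℝ)⁻¹ * p.φ θ' (p.x l)) • p.gradφ l θ := by
  have h1 : (fun a => p.K a θ')
      = fun a => 0 * (fun _ => (0 : ℝ)) a + ∑ l, ((n : ℝ)⁻¹ * p.φ θ' (p.x l)) * p.φ a (p.x l) := by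
    ext a
    simp only [K, dataAvg, Finset.mul_sum, zero_mul, zero_add]
    exact Finset.sum_congr rfl fun l _ => by ring
  rw [gradK, h1, gradient_mul_add_sum (differentiableAt_const _) fun l =>
    (hp.contDiffAt_φ _ (hp.x_mem l) θ hθ).differentiableAt (by norm_num)]
  simp

lemma mixedHessK_eq (hp : p.Regular) {θ θ' : EuclideanSpace ℝ (Fin k)} (hθ : θ ∈ p.D)
    (hθ' : θ' ∈ p.D) :
    p.mixedHessK θ θ' = ∑ l, (n : ℝ)⁻¹ •
      (ContinuousLinearMap.toSpanSingleton ℝ (p.gradφ l θ)).comp (innerSL ℝ (p.gradφ l θ')) := by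
  have h1 : (fun b => p.gradK θ b)
      = fun b => ∑ l, ((n : ℝ)⁻¹ * p.φ b (p.x l)) • p.gradφ l θ :=
    funext fun b => hp.gradK_eq hθ b
  have h2 : HasFDerivAt (fun b => ∑ l, ((n : ℝ)⁻¹ * p.φ b (p.x l)) • p.gradφ l θ)
      (∑ l, ((n : ℝ)⁻¹ • fderiv ℝ (fun a => p.φ a (p.x l)) θ').smulRight (p.gradφ l θ)) θ' :=
    HasFDerivAt.fun_sum fun l _ =>
      ((((hp.contDiffAt_φ _ (hp.x_mem l) θ' hθ').differentiableAt
        (by norm_num)).hasFDerivAt.const_mul _).smul_const _)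
  rw [mixedHessK, h1, h2.fderiv]
  refine Finset.sum_congr rfl fun l _ => ?_
  ext1 v
  simp [mul_smul, inner_gradient_left]

/-- As a function of the position, the potential is a finite linear combination of the regularizer
and the activations at the data points; the measure enters only through `f[μ]`. -/
lemma V_eq {μ : Measure (EuclideanSpace ℝ (Fin k))}
    (hμ : ∀ l, Integrable (fun θ => p.φ θ (p.x l)) μ) :
    p.V μ = fun a => p.lam * p.r a
      + ∑ l, ((n : ℝ)⁻¹ * (p.f μ (p.x l) - p.fstar (p.x l))) * p.φ a (p.x l) := by
  ext a
  have h1 : ∫ θ', p.K a θ' ∂μ = ∑ l, (n : ℝ)⁻¹ * p.f μ (p.x l) * p.φ a (p.x l) := by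
    simp only [K, dataAvg, f]
    rw [integral_const_mul, integral_finsetSum _ fun l _ => (hμ l).const_mul _, Finset.mul_sum]
    refine Finset.sum_congr rfl fun l _ => ?_
    rw [integral_const_mul]; ring
  simp only [V, F, dataAvg, h1, Finset.mul_sum]
  rw [neg_sub, sub_add, sub_eq_add_neg, ← Finset.sum_sub_distrib, ← Finset.sum_neg_distrib]
  congr 1
  exact Finset.sum_congr rfl fun l _ => by ring

lemma hess_V_eq (hp : p.Regular) {μ : Measure (EuclideanSpace ℝ (Fin k))}
    (hμ : ∀ l, Integrable (fun θ => p.φ θ (p.x l)) μ) {θ : EuclideanSpace ℝ (Fin k)}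
    (hθ : θ ∈ p.D) :
    hess (p.V μ) θ = p.lam • hess p.r θ
      + ∑ l, ((n : ℝ)⁻¹ * (p.f μ (p.x l) - p.fstar (p.x l))) •
        hess (fun a => p.φ a (p.x l)) θ := by
  rw [V_eq hμ, hess_mul_add_sum (hp.contDiffAt_r θ hθ) fun l => hp.contDiffAt_φ _ (hp.x_mem l) θ hθ]

end Regular

lemma BoundedBy.nonneg {D' : Set (EuclideanSpace ℝ (Fin k))} {M : ℝ} (hB : p.BoundedBy D' M)
    (hn : 0 < n) : 0 ≤ M :=
  (abs_nonneg _).trans (hB.fstar_le ⟨0, hn⟩)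

/-- The bounds over `D'` extend to its closure, which contains the limits of the flow. -/
lemma BoundedBy.closure {D' : Set (EuclideanSpace ℝ (Fin k))} {M : ℝ} (hp : p.Regular)
    (hB : p.BoundedBy D' M) : p.BoundedBy (closure D') M := by
  have hφ : ∀ l, ContinuousOn (fun a => p.φ a (p.x l)) (_root_.closure D') := fun l a ha =>
    (hp.continuousAt_φ l (hB.closure_subset ha)).continuousWithinAt
  have hg : ∀ l, ContinuousOn (p.gradφ l) (_root_.closure D') := fun l a ha =>
    (hp.continuousAt_gradφ l (hB.closure_subset ha)).continuousWithinAt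
  have hh : ∀ l, ContinuousOn (hess fun a => p.φ a (p.x l)) (_root_.closure D') := fun l a ha =>
    (hp.continuousAt_hessφ l (hB.closure_subset ha)).continuousWithinAt
  have hr : ContinuousOn (hess p.r) (_root_.closure D') := fun a ha =>
    (continuousAt_hess (hp.contDiffAt_r a (hB.closure_subset ha))).continuousWithinAt
  have pair : ∀ {u : EuclideanSpace ℝ (Fin k) → EuclideanSpace ℝ (Fin k) → ℝ},
      ContinuousOn (Function.uncurry u) (_root_.closure D' ×ˢ _root_.closure D') →
      (∀ a ∈ D', ∀ b ∈ D', u a b ≤ M * ‖a - b‖) →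
      ∀ a ∈ _root_.closure D', ∀ b ∈ _root_.closure D', u a b ≤ M * ‖a - b‖ := by
    intro u hu h a ha b hb
    have := le_on_closure (s := D' ×ˢ D') (f := Function.uncurry u)
      (g := fun z => M * ‖z.1 - z.2‖) (fun z hz => h z.1 hz.1 z.2 hz.2)
      (by rwa [closure_prod_eq]) (by fun_prop) (x := (a, b))
      (by rw [closure_prod_eq]; exact ⟨ha, hb⟩)
    exact this
  have fst : ∀ {Y : Type} [TopologicalSpace Y] {u : EuclideanSpace ℝ (Fin k) → Y},
      ContinuousOn u (_root_.closure D') →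
      ContinuousOn (fun z : EuclideanSpace ℝ (Fin k) × EuclideanSpace ℝ (Fin k) => u z.1)
        (_root_.closure D' ×ˢ _root_.closure D') := fun hu =>
    hu.comp continuousOn_fst fun z hz => hz.1
  have snd : ∀ {Y : Type} [TopologicalSpace Y] {u : EuclideanSpace ℝ (Fin k) → Y},
      ContinuousOn u (_root_.closure D') →
      ContinuousOn (fun z : EuclideanSpace ℝ (Fin k) × EuclideanSpace ℝ (Fin k) => u z.2)
        (_root_.closure D' ×ˢ _root_.closure D') := fun hu =>
    hu.comp continuousOn_snd fun z hz => hz.2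
  exact
  { isCompact_closure := by rw [closure_closure]; exact hB.isCompact_closure
    closure_subset := by rw [closure_closure]; exact hB.closure_subset
    fstar_le := hB.fstar_le
    φ_le := fun l a ha => le_on_closure (hB.φ_le l) (hφ l).abs continuousOn_const ha
    grad_le := fun l a ha => le_on_closure (hB.grad_le l) (hg l).norm continuousOn_const ha
    hess_le := fun l a ha => le_on_closure (hB.hess_le l) (hh l).norm continuousOn_const ha
    φ_lip := fun l => pair ((fst (hφ l)).sub (snd (hφ l))).abs (hB.φ_lip l)
    grad_lip := fun l => pair ((fst (hg l)).sub (snd (hg l))).norm (hB.grad_lip l)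
    hess_lip := fun l => pair ((fst (hh l)).sub (snd (hh l))).norm (hB.hess_lip l)
    reg_lip := pair (((fst hr).sub (snd hr)).const_smul p.lam).norm hB.reg_lip }

/-- Every subset of a compact subset of `D` admits a bound `M`. -/
lemma Regular.exists_boundedBy (hp : p.Regular) {Q : Set (EuclideanSpace ℝ (Fin k))}
    (hQ : IsCompact Q) (hQD : Q ⊆ p.D) : ∃ M, p.BoundedBy Q M := by
  have bdd : ∀ {Y : Type} [NormedAddCommGroup Y] {u : Fin n → EuclideanSpace ℝ (Fin k) → Y},
      (∀ l, ContinuousOn (u l) Q) → ∃ C, ∀ l, ∀ a ∈ Q, ‖u l a‖ ≤ C := by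
    intro Y _ u hu
    choose C hC using fun l => hQ.exists_bound_of_continuousOn (hu l)
    exact ⟨∑ l, |C l|, fun l a ha => (hC l a ha).trans ((le_abs_self _).trans
      (Finset.single_le_sum (f := fun l => |C l|) (fun _ _ => abs_nonneg _) (Finset.mem_univ l)))⟩
  have lip : ∀ {Y : Type} [NormedAddCommGroup Y] {u : Fin n → EuclideanSpace ℝ (Fin k) → Y},
      (∀ l, LocallyLipschitzOn Q (u l)) →
      ∃ C, ∀ l, ∀ a ∈ Q, ∀ b ∈ Q, ‖u l a - u l b‖ ≤ C * ‖a - b‖ := by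
    intro Y _ u hu
    choose C hC using fun l => (hu l).exists_lipschitzOnWith_of_compact hQ
    refine ⟨∑ l, (C l : ℝ), fun l a ha b hb => ((hC l).norm_sub_le ha hb).trans ?_⟩
    have : (C l : ℝ) ≤ ∑ l, (C l : ℝ) :=
      Finset.single_le_sum (f := fun l => (C l : ℝ)) (fun _ _ => NNReal.coe_nonneg _)
        (Finset.mem_univ l)
    gcongr
  have lip1 : ∀ {Y : Type} [NormedAddCommGroup Y] [NormedSpace ℝ Y]
      {u : EuclideanSpace ℝ (Fin k) → Y}, (∀ a ∈ Q, ContDiffAt ℝ 1 u a) →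
      LocallyLipschitzOn Q u := by
    intro Y _ _ u hu a ha
    obtain ⟨C, t, ht, hC⟩ := (hu a ha).exists_lipschitzOnWith
    exact ⟨C, t, mem_nhdsWithin_of_mem_nhds ht, hC⟩
  have cφ := fun l a (ha : a ∈ Q) => hp.contDiffAt_φ _ (hp.x_mem l) a (hQD ha)
  obtain ⟨c1, h1⟩ := bdd (u := fun l a => p.φ a (p.x l))
    fun l a ha => (hp.continuousAt_φ l (hQD ha)).continuousWithinAt
  obtain ⟨c2, h2⟩ := bdd (u := fun l => p.gradφ l)
    fun l a ha => (hp.continuousAt_gradφ l (hQD ha)).continuousWithinAt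
  obtain ⟨c3, h3⟩ := bdd (u := fun l => hess fun a => p.φ a (p.x l))
    fun l a ha => (hp.continuousAt_hessφ l (hQD ha)).continuousWithinAt
  obtain ⟨c4, h4⟩ := lip (u := fun l a => p.φ a (p.x l))
    fun l => lip1 fun a ha => (cφ l a ha).of_le (by norm_num)
  obtain ⟨c5, h5⟩ := lip (u := fun l => p.gradφ l)
    fun l => lip1 fun a ha => contDiffAt_gradient (cφ l a ha)
  obtain ⟨L, hL⟩ := hp.lipschitz_hess_φ
  obtain ⟨R, hR⟩ := (hp.lipschitz_hess_r.mono hQD).exists_lipschitzOnWith_of_compact hQ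
  set M := |c1| + |c2| + |c3| + |c4| + |c5| + L + |p.lam| * R + ∑ l, |p.fstar (p.x l)| with hM
  have hs : 0 ≤ ∑ l, |p.fstar (p.x l)| := Finset.sum_nonneg fun _ _ => abs_nonneg _
  have hr : 0 ≤ |p.lam| * R := by positivity
  have hL0 : (0 : ℝ) ≤ L := L.2
  have ab := fun c : ℝ => (⟨abs_nonneg c, le_abs_self c⟩ : 0 ≤ |c| ∧ c ≤ |c|)
  have := ab c1
  have := ab c2
  have := ab c3
  have := ab c4
  have := ab c5
  refine ⟨M, ⟨by rwa [hQ.isClosed.closure_eq], by rwa [hQ.isClosed.closure_eq], ?_, ?_, ?_, ?_,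
    ?_, ?_, ?_, ?_⟩⟩
  · intro l
    have : |p.fstar (p.x l)| ≤ ∑ l, |p.fstar (p.x l)| :=
      Finset.single_le_sum (f := fun l => |p.fstar (p.x l)|) (fun _ _ => abs_nonneg _)
        (Finset.mem_univ l)
    linarith
  · exact fun l a ha => (h1 l a ha).trans (by linarith)
  · exact fun l a ha => (h2 l a ha).trans (by linarith)
  · exact fun l a ha => (h3 l a ha).trans (by linarith)
  · exact fun l a ha b hb => (h4 l a ha b hb).trans
      (mul_le_mul_of_nonneg_right (by linarith) (norm_nonneg _))
  · exact fun l a ha b hb => (h5 l a ha b hb).trans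
      (mul_le_mul_of_nonneg_right (by linarith) (norm_nonneg _))
  · exact fun l a ha b hb => ((hL _ (hp.x_mem l)).norm_sub_le (hQD ha) (hQD hb)).trans
      (mul_le_mul_of_nonneg_right (by linarith) (norm_nonneg _))
  · intro a ha b hb
    rw [norm_smul, Real.norm_eq_abs]
    calc |p.lam| * ‖hess p.r a - hess p.r b‖ ≤ |p.lam| * (R * ‖a - b‖) :=
          mul_le_mul_of_nonneg_left (hR.norm_sub_le ha hb) (abs_nonneg _)
      _ = |p.lam| * R * ‖a - b‖ := by ring
      _ ≤ M * ‖a - b‖ := mul_le_mul_of_nonneg_right (by linarith) (norm_nonneg _)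

lemma BoundedBy.mono {Q Q' : Set (EuclideanSpace ℝ (Fin k))} {M : ℝ} (hB : p.BoundedBy Q M)
    (h : Q' ⊆ Q) : p.BoundedBy Q' M where
  isCompact_closure := hB.isCompact_closure.of_isClosed_subset isClosed_closure (closure_mono h)
  closure_subset := (closure_mono h).trans hB.closure_subset
  fstar_le := hB.fstar_le
  φ_le l a ha := hB.φ_le l a (h ha)
  grad_le l a ha := hB.grad_le l a (h ha)
  hess_le l a ha := hB.hess_le l a (h ha)
  φ_lip l a ha b hb := hB.φ_lip l a (h ha) b (h hb)
  grad_lip l a ha b hb := hB.grad_lip l a (h ha) b (h hb)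
  hess_lip l a ha b hb := hB.hess_lip l a (h ha) b (h hb)
  reg_lip a ha b hb := hB.reg_lip a (h ha) b (h hb)

/-- The constant by which the Hessian of the potential depends on the position and on the
measure. -/
def hessLip (M : ℝ) : ℝ := 1 + |M| + 2 * M ^ 2

lemma hessLip_pos (M : ℝ) : 0 < hessLip M := by unfold hessLip; positivity

lemma norm_dataSum_le {Y : Type*} [NormedAddCommGroup Y] [NormedSpace ℝ Y] (hn : 0 < n)
    {v : Fin n → Y} {c : ℝ} (h : ∀ l, ‖v l‖ ≤ c) : ‖∑ l, (n : ℝ)⁻¹ • v l‖ ≤ c := by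
  have hn' : (0 : ℝ) < n := by exact_mod_cast hn
  calc ‖∑ l, (n : ℝ)⁻¹ • v l‖ ≤ ∑ l : Fin n, (n : ℝ)⁻¹ * c := by
        refine norm_sum_le_of_le _ fun l _ => ?_
        rw [norm_smul, Real.norm_of_nonneg (by positivity)]
        exact mul_le_mul_of_nonneg_left (h l) (by positivity)
    _ = c := by
        rw [Finset.sum_const, Finset.card_univ, Fintype.card_fin, nsmul_eq_mul]
        field_simp

lemma BoundedBy.norm_hess_V_sub_le {Q : Set (EuclideanSpace ℝ (Fin k))} {M e : ℝ}
    (hp : p.Regular) (hB : p.BoundedBy Q M) {μ ν : Measure (EuclideanSpace ℝ (Fin k))}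
    (hμ : ∀ l, Integrable (fun θ => p.φ θ (p.x l)) μ)
    (hν : ∀ l, Integrable (fun θ => p.φ θ (p.x l)) ν)
    (hfμ : ∀ l, |p.f μ (p.x l)| ≤ M) (he : ∀ l, |p.f μ (p.x l) - p.f ν (p.x l)| ≤ M * e)
    (he0 : 0 ≤ e) {a b : EuclideanSpace ℝ (Fin k)} (ha : a ∈ Q) (hb : b ∈ Q) :
    ‖hess (p.V μ) a - hess (p.V ν) b‖ ≤ hessLip M * (‖a - b‖ + e) := by
  have hM := hB.nonneg hp.n_pos
  rw [hp.hess_V_eq hμ (hB.closure_subset (subset_closure ha)),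
    hp.hess_V_eq hν (hB.closure_subset (subset_closure hb))]
  have h1 : p.lam • hess p.r a
      + ∑ l, ((n : ℝ)⁻¹ * (p.f μ (p.x l) - p.fstar (p.x l))) • hess (fun a => p.φ a (p.x l)) a
      - (p.lam • hess p.r b
      + ∑ l, ((n : ℝ)⁻¹ * (p.f ν (p.x l) - p.fstar (p.x l))) • hess (fun a => p.φ a (p.x l)) b)
      = p.lam • (hess p.r a - hess p.r b) + ∑ l, (n : ℝ)⁻¹ •
        ((p.f μ (p.x l) - p.fstar (p.x l)) •
            (hess (fun a => p.φ a (p.x l)) a - hess (fun a => p.φ a (p.x l)) b)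
          + (p.f μ (p.x l) - p.f ν (p.x l)) • hess (fun a => p.φ a (p.x l)) b) := by
    rw [add_sub_add_comm, smul_sub, ← Finset.sum_sub_distrib]
    congr 1
    refine Finset.sum_congr rfl fun l _ => ?_
    module
  rw [h1]
  have h2 : ∀ l, ‖(p.f μ (p.x l) - p.fstar (p.x l)) •
            (hess (fun a => p.φ a (p.x l)) a - hess (fun a => p.φ a (p.x l)) b)
          + (p.f μ (p.x l) - p.f ν (p.x l)) • hess (fun a => p.φ a (p.x l)) b‖
      ≤ 2 * M * (M * ‖a - b‖) + M * e * M := by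
    intro l
    refine (norm_add_le _ _).trans ?_
    rw [norm_smul, norm_smul, Real.norm_eq_abs, Real.norm_eq_abs]
    have h3 : |p.f μ (p.x l) - p.fstar (p.x l)| ≤ 2 * M := by
      have := abs_sub (p.f μ (p.x l)) (p.fstar (p.x l))
      linarith [hfμ l, hB.fstar_le l]
    have h4 := hB.hess_lip l a ha b hb
    have h5 := he l
    have h6 := hB.hess_le l b hb
    gcongr
  refine (norm_add_le _ _).trans ?_
  have h7 := norm_dataSum_le hp.n_pos h2
  have h8 := hB.reg_lip a ha b hb
  have h9 : 0 ≤ ‖a - b‖ := norm_nonneg _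
  rw [hessLip, abs_of_nonneg hM]
  nlinarith [mul_nonneg hM he0, mul_nonneg (sq_nonneg M) he0, mul_nonneg (sq_nonneg M) h9]

end Problem

/-! ### The linearized flow as an equation forced by the fluctuation of the function -/

namespace Problem

section Forcing

variable {k d n : ℕ} {p : Problem k d n} {S : Type*} [MeasurableSpace S] {P : Measure S}
  {μ₀ : Measure (EuclideanSpace ℝ (Fin k))}
  {Θ : ℝ → EuclideanSpace ℝ (Fin k) → EuclideanSpace ℝ (Fin k)}
  {ω₀ : Lp ℝ 2 μ₀ →ₗ[ℝ] Lp ℝ 2 P}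
  {T : ℝ → EuclideanSpace ℝ (Fin k) → Lp (EuclideanSpace ℝ (Fin k)) 2 P}

lemma IsCharFlow.continuousOn_comp (hΘ : p.IsCharFlow μ₀ Θ) {Y : Type*} [TopologicalSpace Y]
    {u : EuclideanSpace ℝ (Fin k) → Y} (hu : ∀ θ ∈ p.D, ContinuousAt u θ) :
    ContinuousOn (Function.uncurry fun t θ => u (Θ t θ)) (Ici 0 ×ˢ μ₀.support) := by
  intro z hz
  exact ContinuousAt.comp_continuousWithinAt (f := Function.uncurry Θ)
    (hu _ (hΘ.mem_D z.1 hz.1 z.2 hz.2)) (hΘ.continuousOn z hz)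

variable (p Θ ω₀ T) in
/-- The mean square `𝔼 ‖g_t‖²_ν̂` as a real number. -/
def meanSq (t : ℝ) : ℝ := ∑ l, (n : ℝ)⁻¹ * ‖p.g Θ ω₀ T t (p.x l)‖ ^ 2

variable (p Θ ω₀) in
/-- The Monte-Carlo part `∫ φ(Θ_t(θ), x_l) ω₀(dθ)` of the fluctuation. -/
def sampling (t : ℝ) (l : Fin n) : Lp ℝ 2 P := noiseInt ω₀ fun θ => p.φ (Θ t θ) (p.x l)

variable (p Θ ω₀ T) in
/-- The force `∫ ∇φ(Θ_t(θ), x) g_t(x) ν̂(dx)` which the fluctuation `g_t` of the represented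
function exerts on the particle that started at `θ`. -/
def forcing (t : ℝ) (θ : EuclideanSpace ℝ (Fin k)) : Lp (EuclideanSpace ℝ (Fin k)) 2 P :=
  ∑ l, (n : ℝ)⁻¹ •
    (ContinuousLinearMap.toSpanSingleton ℝ (p.gradφ l (Θ t θ))).compLp (p.g Θ ω₀ T t (p.x l))

lemma meanSq_nonneg (t : ℝ) : 0 ≤ p.meanSq Θ ω₀ T t :=
  Finset.sum_nonneg fun _ _ => by positivity

lemma expSqNorm_eq (hn : 0 < n) (t : ℝ) :
    p.expSqNorm (p.g Θ ω₀ T t) = ENNReal.ofReal (p.meanSq Θ ω₀ T t) := by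
  have h1 : ∀ q : Lp ℝ 2 P, ∫⁻ s, ‖q s‖ₑ ^ 2 ∂P = ENNReal.ofReal (‖q‖ ^ 2) := by
    intro q
    have h2 := Lp.norm_def q
    have h3 : eLpNorm q 2 P ^ 2 = ∫⁻ s, ‖q s‖ₑ ^ 2 ∂P := by
      have := eLpNorm_nnreal_pow_eq_lintegral (f := (q : S → ℝ)) (μ := P) (p := 2) (by norm_num)
      simpa using this
    rw [← h3, h2, ENNReal.ofReal_pow ENNReal.toReal_nonneg,
      ENNReal.ofReal_toReal (Lp.eLpNorm_ne_top q)]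
  have h4 : (n : ℝ≥0∞)⁻¹ = ENNReal.ofReal (n : ℝ)⁻¹ := by
    rw [ENNReal.ofReal_inv_of_pos (by exact_mod_cast hn), ENNReal.ofReal_natCast]
  simp only [expSqNorm, h1, meanSq]
  rw [← Finset.mul_sum, ENNReal.ofReal_mul (by positivity),
    ENNReal.ofReal_sum_of_nonneg fun _ _ => by positivity, h4]

variable [IsProbabilityMeasure P] [IsProbabilityMeasure μ₀]

section

variable (hp : p.Regular) (hK : IsCompact μ₀.support) (hΘ : p.IsCharFlow μ₀ Θ)
include hp hK hΘ

lemma memLp_φ_flow {t : ℝ} (ht : 0 ≤ t) (l : Fin n) :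
    MemLp (fun θ => p.φ (Θ t θ) (p.x l)) 2 μ₀ := by
  have hc := continuousOn_slice (hΘ.continuousOn_comp fun θ hθ => hp.continuousAt_φ l hθ) ht
  exact (memLp_two_iff_integrable_sq
    (integrable_of_continuousOn_compact hK Measure.support_mem_ae hc).1).2
    (integrable_of_continuousOn_compact hK Measure.support_mem_ae (hc.pow 2))

variable (hT : p.IsFlowFluctuation Θ ω₀ T)
include hT

omit [IsProbabilityMeasure μ₀] hK in
lemma continuousOn_gradφ_T (l : Fin n) :
    ContinuousOn (Function.uncurry fun t θ => (innerSL ℝ (p.gradφ l (Θ t θ))).compLp (T t θ))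
      (Ici 0 ×ˢ μ₀.support) := by
  have h := hΘ.continuousOn_comp fun θ hθ => hp.continuousAt_gradφ l hθ
  exact ContinuousOn.compLp ((innerSL ℝ).continuous.comp_continuousOn h) hT.continuousOn

lemma integrable_gradφ_T {t : ℝ} (ht : 0 ≤ t) (l : Fin n) :
    Integrable (fun θ => (innerSL ℝ (p.gradφ l (Θ t θ))).compLp (T t θ)) μ₀ :=
  integrable_of_continuousOn_compact hK Measure.support_mem_ae
    (continuousOn_slice (continuousOn_gradφ_T hp hΘ hT l) ht)

/-- The interaction and noise terms of the linearized flow combine into the force exerted by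
`g_t`: the kernel is the composition of the feature gradients with their adjoints. -/
lemma interaction_add_noise_eq_forcing {t : ℝ} (ht : 0 ≤ t) {θ : EuclideanSpace ℝ (Fin k)}
    (hθ : θ ∈ μ₀.support) :
    (∫ θ', (p.mixedHessK (Θ t θ) (Θ t θ')).compLp (T t θ') ∂μ₀)
      + (noiseIntVec ω₀ fun θ' => p.gradK (Θ t θ) (Θ t θ')) = p.forcing Θ ω₀ T t θ := by
  have hD := hΘ.mem_D t ht θ hθ
  have h1 : ∫ θ', (p.mixedHessK (Θ t θ) (Θ t θ')).compLp (T t θ') ∂μ₀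
      = ∑ l, (n : ℝ)⁻¹ • (ContinuousLinearMap.toSpanSingleton ℝ (p.gradφ l (Θ t θ))).compLp
        (∫ θ', (innerSL ℝ (p.gradφ l (Θ t θ'))).compLp (T t θ') ∂μ₀) := by
    have h2 : ∀ᵐ θ' ∂μ₀, (p.mixedHessK (Θ t θ) (Θ t θ')).compLp (T t θ')
        = ∑ l, (n : ℝ)⁻¹ • (ContinuousLinearMap.compLpL 2 P
          (ContinuousLinearMap.toSpanSingleton ℝ (p.gradφ l (Θ t θ))))
          ((innerSL ℝ (p.gradφ l (Θ t θ'))).compLp (T t θ')) := by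
      filter_upwards [Measure.support_mem_ae] with θ' hθ'
      rw [hp.mixedHessK_eq hD (hΘ.mem_D t ht θ' hθ'), sum_compLp]
      refine Finset.sum_congr rfl fun l _ => ?_
      rw [ContinuousLinearMap.smul_compLp, comp_compLp]
      rfl
    rw [integral_congr_ae h2, integral_finsetSum]
    · refine Finset.sum_congr rfl fun l _ => ?_
      rw [integral_smul, ContinuousLinearMap.integral_comp_comm _
        (integrable_gradφ_T hp hK hΘ hT ht l)]
      rfl
    · exact fun l _ => Integrable.smul (n : ℝ)⁻¹ (ContinuousLinearMap.integrable_comp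
        (ContinuousLinearMap.compLpL 2 P
          (ContinuousLinearMap.toSpanSingleton ℝ (p.gradφ l (Θ t θ))))
        (integrable_gradφ_T hp hK hΘ hT ht l))
  have h3 : (noiseIntVec ω₀ fun θ' => p.gradK (Θ t θ) (Θ t θ'))
      = ∑ l, (n : ℝ)⁻¹ • (ContinuousLinearMap.toSpanSingleton ℝ (p.gradφ l (Θ t θ))).compLp
        (p.sampling Θ ω₀ t l) := by
    have h4 : (fun θ' => p.gradK (Θ t θ) (Θ t θ'))
        = fun θ' => ∑ l, p.φ (Θ t θ') (p.x l) • ((n : ℝ)⁻¹ • p.gradφ l (Θ t θ)) := by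
      ext1 θ'
      rw [hp.gradK_eq hD]
      exact Finset.sum_congr rfl fun l _ => by rw [smul_smul, mul_comm]
    rw [h4, noiseIntVec_sum _ _ fun l => memLp_φ_flow hp hK hΘ ht l]
    refine Finset.sum_congr rfl fun l _ => ?_
    rw [← ContinuousLinearMap.smul_compLp]
    congr 1
    ext1
    simp
  rw [h1, h3, ← Finset.sum_add_distrib, forcing]
  refine Finset.sum_congr rfl fun l _ => ?_
  rw [← smul_add]
  congr 1
  have := map_add (ContinuousLinearMap.compLpL 2 P
    (ContinuousLinearMap.toSpanSingleton ℝ (p.gradφ l (Θ t θ))))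
    (p.sampling Θ ω₀ t l) (∫ θ', (innerSL ℝ (p.gradφ l (Θ t θ'))).compLp (T t θ') ∂μ₀)
  rw [add_comm]
  exact this.symm

/-- The total work of the force on the particles is `𝔼 ⟪g_t - ḡ_t, g_t⟫_ν̂`, with `ḡ_t` the
Monte-Carlo part of `g_t`. -/
lemma integral_inner_forcing {t : ℝ} (ht : 0 ≤ t) :
    ∫ θ, inner ℝ (T t θ) (p.forcing Θ ω₀ T t θ) ∂μ₀
      = ∑ l, (n : ℝ)⁻¹ * inner ℝ (p.g Θ ω₀ T t (p.x l) - p.sampling Θ ω₀ t l)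
        (p.g Θ ω₀ T t (p.x l)) := by
  have h1 : ∀ θ, inner ℝ (T t θ) (p.forcing Θ ω₀ T t θ)
      = ∑ l, (n : ℝ)⁻¹ * inner ℝ (p.g Θ ω₀ T t (p.x l))
        ((innerSL ℝ (p.gradφ l (Θ t θ))).compLp (T t θ)) := by
    intro θ
    rw [forcing, inner_sum]
    refine Finset.sum_congr rfl fun l _ => ?_
    rw [real_inner_smul_right, inner_toSpanSingleton_compLp, real_inner_comm]
  simp_rw [h1]
  rw [integral_finsetSum]
  · refine Finset.sum_congr rfl fun l _ => ?_
    rw [integral_const_mul, integral_inner (integrable_gradφ_T hp hK hΘ hT ht l),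
      real_inner_comm]
    congr 2
    simp only [g, sampling, add_sub_cancel_left]
  · exact fun l _ => ((integrable_gradφ_T hp hK hΘ hT ht l).const_inner _).const_mul _

variable (hω : IsGaussianFluctuation P μ₀ ω₀)
include hω

lemma continuousOn_g (l : Fin n) : ContinuousOn (fun t => p.g Θ ω₀ T t (p.x l)) (Ici 0) :=
  (continuousOn_noiseInt hω hK Measure.support_mem_ae
    (hΘ.continuousOn_comp fun _ hθ => hp.continuousAt_φ l hθ)).add
    (continuousOn_integral_of_compact hK Measure.support_mem_ae
      (continuousOn_gradφ_T hp hΘ hT l))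

lemma continuousOn_meanSq : ContinuousOn (p.meanSq Θ ω₀ T) (Ici 0) :=
  continuousOn_finsetSum _ fun l _ =>
    continuousOn_const.mul ((continuousOn_g hp hK hΘ hT hω l).norm.pow 2)

lemma continuousOn_forcing :
    ContinuousOn (Function.uncurry (p.forcing Θ ω₀ T)) (Ici 0 ×ˢ μ₀.support) := by
  change ContinuousOn (fun z : ℝ × EuclideanSpace ℝ (Fin k) => ∑ l, (n : ℝ)⁻¹ •
    (ContinuousLinearMap.toSpanSingleton ℝ (p.gradφ l (Θ z.1 z.2))).compLp
      (p.g Θ ω₀ T z.1 (p.x l))) _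
  refine continuousOn_finsetSum _ fun l _ => ContinuousOn.fun_const_smul ?_ (n : ℝ)⁻¹
  have hg : ContinuousOn (fun z : ℝ × EuclideanSpace ℝ (Fin k) => p.g Θ ω₀ T z.1 (p.x l))
      (Ici 0 ×ˢ μ₀.support) :=
    (continuousOn_g hp hK hΘ hT hω l).comp continuousOn_fst fun z hz => hz.1
  refine ContinuousOn.compLp ?_ hg
  have h := hΘ.continuousOn_comp fun θ hθ => hp.continuousAt_gradφ l hθ
  exact (ContinuousLinearMap.toSpanSingletonCLE (𝕜 := ℝ)
    (E := EuclideanSpace ℝ (Fin k))).continuous.comp_continuousOn h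

end

omit [IsProbabilityMeasure P] [IsProbabilityMeasure μ₀] in
lemma norm_sq_forcing_le {Q : Set (EuclideanSpace ℝ (Fin k))} {M : ℝ} (hn : 0 < n)
    (hB : p.BoundedBy Q M) {t : ℝ} {θ : EuclideanSpace ℝ (Fin k)} (hQ : Θ t θ ∈ Q) :
    ‖p.forcing Θ ω₀ T t θ‖ ^ 2 ≤ M ^ 2 * p.meanSq Θ ω₀ T t := by
  have hM := hB.nonneg hn
  have hn' : (0 : ℝ) < n := by exact_mod_cast hn
  have h1 : ‖p.forcing Θ ω₀ T t θ‖ ≤ ∑ l, (n : ℝ)⁻¹ * (M * ‖p.g Θ ω₀ T t (p.x l)‖) := by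
    refine norm_sum_le_of_le _ fun l _ => ?_
    rw [norm_smul, Real.norm_of_nonneg (by positivity)]
    refine mul_le_mul_of_nonneg_left ?_ (by positivity)
    refine (ContinuousLinearMap.norm_compLp_le _ _).trans ?_
    rw [ContinuousLinearMap.norm_toSpanSingleton]
    exact mul_le_mul_of_nonneg_right (hB.grad_le l _ hQ) (norm_nonneg _)
  calc ‖p.forcing Θ ω₀ T t θ‖ ^ 2
      ≤ (∑ l, (n : ℝ)⁻¹ * (M * ‖p.g Θ ω₀ T t (p.x l)‖)) ^ 2 := by gcongr
    _ ≤ (n : ℝ) * ∑ l, ((n : ℝ)⁻¹ * (M * ‖p.g Θ ω₀ T t (p.x l)‖)) ^ 2 := by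
        have := sq_sum_le_card_mul_sum_sq (s := Finset.univ)
          (f := fun l => (n : ℝ)⁻¹ * (M * ‖p.g Θ ω₀ T t (p.x l)‖))
        simpa using this
    _ = M ^ 2 * p.meanSq Θ ω₀ T t := by
        rw [meanSq, Finset.mul_sum, Finset.mul_sum]
        refine Finset.sum_congr rfl fun l _ => ?_
        field_simp

end Forcing

end Problem

/-! ### Convergence of the flow and the defect of convexity along it -/

/-- The tails of a finite integral over a half-line tend to zero. -/
lemma tendsto_setLIntegral_Ioi_zero {h : ℝ → ℝ≥0∞} {a : ℝ} (ha : ∫⁻ s in Ioi a, h s ≠ ⊤) :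
    Tendsto (fun t => ∫⁻ s in Ioi t, h s) atTop (𝓝 0) := by
  have h1 : ∀ t, ∫⁻ s in Ioi t, h s = (volume.withDensity h) (Ioi t) := fun t =>
    (withDensity_apply h measurableSet_Ioi).symm
  simp_rw [h1] at ha ⊢
  have h2 := tendsto_measure_iInter_atTop (μ := volume.withDensity h) (s := fun t : ℝ => Ioi t)
    (fun t => measurableSet_Ioi.nullMeasurableSet) (fun s t hst => Ioi_subset_Ioi hst) ⟨a, ha⟩
  have h3 : ⋂ t : ℝ, Ioi t = ∅ := by
    ext x
    simp only [mem_iInter, mem_Ioi, mem_empty_iff_false, iff_false, not_forall, not_lt]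
    exact ⟨x, le_rfl⟩
  rw [h3, measure_empty] at h2
  exact h2

namespace Problem

section Flow

variable {k d n : ℕ} {p : Problem k d n} {μ₀ : Measure (EuclideanSpace ℝ (Fin k))}
  [IsProbabilityMeasure μ₀]
  {Θ : ℝ → EuclideanSpace ℝ (Fin k) → EuclideanSpace ℝ (Fin k)}
  {Θinf : EuclideanSpace ℝ (Fin k) → EuclideanSpace ℝ (Fin k)}
  {Q : Set (EuclideanSpace ℝ (Fin k))} {M : ℝ}

variable (p μ₀ Θ Θinf Q M) in
/-- A flow that stays in a compact set `Q` on which the data of the problem are bounded by `M`,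
and that converges almost surely. -/
structure ConvergesIn : Prop where
  regular : p.Regular
  flow : p.IsCharFlow μ₀ Θ
  compact_support : IsCompact μ₀.support
  compact : IsCompact Q
  bounded : p.BoundedBy Q M
  mem : ∀ t, 0 ≤ t → ∀ θ ∈ μ₀.support, Θ t θ ∈ Q
  tendsto : ∀ᵐ θ ∂μ₀, Tendsto (fun t => Θ t θ) atTop (𝓝 (Θinf θ))

section PushForward

variable {Ψ : EuclideanSpace ℝ (Fin k) → EuclideanSpace ℝ (Fin k)}

lemma integrable_map (hQ : IsCompact Q) (hΨ : AEMeasurable Ψ μ₀) (hΨQ : ∀ᵐ θ ∂μ₀, Ψ θ ∈ Q)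
    {u : EuclideanSpace ℝ (Fin k) → ℝ} (hu : ContinuousOn u Q) : Integrable u (μ₀.map Ψ) := by
  have : IsProbabilityMeasure (μ₀.map Ψ) := Measure.isProbabilityMeasure_map hΨ
  exact integrable_of_continuousOn_compact hQ
    ((ae_map_iff hΨ hQ.measurableSet).2 hΨQ) hu

lemma integral_map_eq (hQ : IsCompact Q) (hΨ : AEMeasurable Ψ μ₀) (hΨQ : ∀ᵐ θ ∂μ₀, Ψ θ ∈ Q)
    {u : EuclideanSpace ℝ (Fin k) → ℝ} (hu : ContinuousOn u Q) :
    ∫ θ, u θ ∂(μ₀.map Ψ) = ∫ θ, u (Ψ θ) ∂μ₀ :=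
  integral_map hΨ (integrable_map hQ hΨ hΨQ hu).1

lemma integrable_comp (hQ : IsCompact Q) (hΨ : AEMeasurable Ψ μ₀) (hΨQ : ∀ᵐ θ ∂μ₀, Ψ θ ∈ Q)
    {u : EuclideanSpace ℝ (Fin k) → ℝ} (hu : ContinuousOn u Q) :
    Integrable (fun θ => u (Ψ θ)) μ₀ :=
  (integrable_map hQ hΨ hΨQ hu).comp_aemeasurable hΨ

end PushForward

/-- The mean distance `∫ |Θ_t - Θ_∞| dμ₀` to the limit. -/
def meanDist (μ₀ : Measure (EuclideanSpace ℝ (Fin k)))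
    (Θ : ℝ → EuclideanSpace ℝ (Fin k) → EuclideanSpace ℝ (Fin k))
    (Θinf : EuclideanSpace ℝ (Fin k) → EuclideanSpace ℝ (Fin k)) (t : ℝ) : ℝ :=
  ∫ θ, ‖Θ t θ - Θinf θ‖ ∂μ₀

/-- The amount by which the Hessian of the potential at time `t` along the path of `θ` can differ
from its value in the limit. -/
def defect (M : ℝ) (μ₀ : Measure (EuclideanSpace ℝ (Fin k)))
    (Θ : ℝ → EuclideanSpace ℝ (Fin k) → EuclideanSpace ℝ (Fin k))
    (Θinf : EuclideanSpace ℝ (Fin k) → EuclideanSpace ℝ (Fin k))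
    (θ : EuclideanSpace ℝ (Fin k)) (t : ℝ) : ℝ :=
  hessLip M * (‖Θ t θ - Θinf θ‖ + meanDist μ₀ Θ Θinf t)

omit [IsProbabilityMeasure μ₀] in
lemma defect_nonneg (θ : EuclideanSpace ℝ (Fin k)) (t : ℝ) : 0 ≤ defect M μ₀ Θ Θinf θ t :=
  mul_nonneg (hessLip_pos M).le (add_nonneg (norm_nonneg _) (integral_nonneg fun _ => norm_nonneg _))

namespace ConvergesIn

omit [IsProbabilityMeasure μ₀] in
lemma continuousOn_φ (h : p.ConvergesIn μ₀ Θ Θinf Q M) (l : Fin n) :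
    ContinuousOn (fun a => p.φ a (p.x l)) Q := fun _ ha =>
  (h.regular.continuousAt_φ l (h.bounded.closure_subset (subset_closure ha))).continuousWithinAt

lemma aemeasurable (h : p.ConvergesIn μ₀ Θ Θinf Q M) {t : ℝ} (ht : 0 ≤ t) :
    AEMeasurable (Θ t) μ₀ :=
  (integrable_of_continuousOn_compact h.compact_support Measure.support_mem_ae
    (continuousOn_slice h.flow.continuousOn ht)).aemeasurable

lemma aemeasurable_lim (h : p.ConvergesIn μ₀ Θ Θinf Q M) : AEMeasurable Θinf μ₀ := by
  refine aemeasurable_of_tendsto_metrizable_ae (atTop : Filter ℕ) (f := fun N : ℕ => Θ N)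
    (fun N => h.aemeasurable N.cast_nonneg) ?_
  filter_upwards [h.tendsto] with θ hθ
  exact hθ.comp tendsto_natCast_atTop_atTop

omit [IsProbabilityMeasure μ₀] in
lemma mem_ae (h : p.ConvergesIn μ₀ Θ Θinf Q M) {t : ℝ} (ht : 0 ≤ t) : ∀ᵐ θ ∂μ₀, Θ t θ ∈ Q := by
  filter_upwards [Measure.support_mem_ae] with θ hθ using h.mem t ht θ hθ

omit [IsProbabilityMeasure μ₀] in
lemma lim_mem (h : p.ConvergesIn μ₀ Θ Θinf Q M) : ∀ᵐ θ ∂μ₀, Θinf θ ∈ Q := by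
  filter_upwards [Measure.support_mem_ae, h.tendsto] with θ hθ hlim
  refine h.compact.isClosed.mem_of_tendsto hlim ?_
  filter_upwards [eventually_ge_atTop 0] with t ht using h.mem t ht θ hθ

omit [IsProbabilityMeasure μ₀] in
lemma exists_dist_le (h : p.ConvergesIn μ₀ Θ Θinf Q M) :
    ∃ R, ∀ᵐ θ ∂μ₀, ∀ t, 0 ≤ t → ‖Θ t θ - Θinf θ‖ ≤ R := by
  obtain ⟨R, hR⟩ := h.compact.isBounded.exists_norm_le
  refine ⟨R + R, ?_⟩
  filter_upwards [Measure.support_mem_ae, h.lim_mem] with θ hθ hlim t ht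
  exact (norm_sub_le _ _).trans (add_le_add (hR _ (h.mem t ht θ hθ)) (hR _ hlim))

lemma integrable_dist (h : p.ConvergesIn μ₀ Θ Θinf Q M) {t : ℝ} (ht : 0 ≤ t) :
    Integrable (fun θ => Θ t θ - Θinf θ) μ₀ := by
  obtain ⟨R, hR⟩ := h.exists_dist_le
  refine Integrable.of_bound ((h.aemeasurable ht).sub h.aemeasurable_lim).aestronglyMeasurable R ?_
  filter_upwards [hR] with θ hθ using hθ t ht

lemma continuousOn_meanDist (h : p.ConvergesIn μ₀ Θ Θinf Q M) :
    ContinuousOn (meanDist μ₀ Θ Θinf) (Ici 0) := by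
  obtain ⟨R, hR⟩ := h.exists_dist_le
  intro t ht
  refine continuousWithinAt_of_dominated (bound := fun _ => R) ?_ ?_ (integrable_const _) ?_
  · filter_upwards [self_mem_nhdsWithin] with s hs
    exact (h.integrable_dist hs).norm.1
  · filter_upwards [self_mem_nhdsWithin] with s hs
    filter_upwards [hR] with θ hθ
    rw [norm_norm]
    exact hθ s hs
  · filter_upwards [Measure.support_mem_ae] with θ hθ
    exact ((continuousOn_slice_time h.flow.continuousOn hθ).sub continuousOn_const).norm t ht

lemma continuousOn_defect (h : p.ConvergesIn μ₀ Θ Θinf Q M) {θ : EuclideanSpace ℝ (Fin k)}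
    (hθ : θ ∈ μ₀.support) : ContinuousOn (defect M μ₀ Θ Θinf θ) (Ici 0) :=
  continuousOn_const.mul ((((continuousOn_slice_time h.flow.continuousOn hθ).sub
    continuousOn_const).norm).add h.continuousOn_meanDist)

/-- Along the flow, the Hessian of the potential is bounded below by the curvature in the limit,
up to the defect. -/
lemma curvature_along_flow (h : p.ConvergesIn μ₀ Θ Θinf Q M) {σ : ℝ}
    (hσ : ∀ θ ∈ (μ₀.map Θinf).support, ∀ v : EuclideanSpace ℝ (Fin k), v ≠ 0 →
      σ * ‖v‖ ^ 2 < inner ℝ v (hess (p.V (μ₀.map Θinf)) θ v)) :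
    ∀ᵐ θ ∂μ₀, ∀ t, 0 ≤ t → ∀ v : EuclideanSpace ℝ (Fin k),
      (σ - defect M μ₀ Θ Θinf θ t) * ‖v‖ ^ 2
        ≤ inner ℝ v (hess (p.V (μ₀.map (Θ t))) (Θ t θ) v) := by
  have hM := h.bounded.nonneg h.regular.n_pos
  have hsupp : ∀ᵐ θ ∂μ₀, Θinf θ ∈ (μ₀.map Θinf).support :=
    ae_of_ae_map h.aemeasurable_lim Measure.support_mem_ae
  have hint_inf := fun l => integrable_map h.compact h.aemeasurable_lim h.lim_mem
    (h.continuousOn_φ l)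
  filter_upwards [hsupp, h.lim_mem, Measure.support_mem_ae] with θ h1 h2 h3 t ht v
  have hint := fun l => integrable_map h.compact (h.aemeasurable ht) (h.mem_ae ht)
    (h.continuousOn_φ l)
  have hf : ∀ l, p.f (μ₀.map (Θ t)) (p.x l) = ∫ a, p.φ (Θ t a) (p.x l) ∂μ₀ := fun l =>
    integral_map_eq h.compact (h.aemeasurable ht) (h.mem_ae ht) (h.continuousOn_φ l)
  have hf' : ∀ l, p.f (μ₀.map Θinf) (p.x l) = ∫ a, p.φ (Θinf a) (p.x l) ∂μ₀ := fun l =>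
    integral_map_eq h.compact h.aemeasurable_lim h.lim_mem (h.continuousOn_φ l)
  have hfM : ∀ l, |p.f (μ₀.map (Θ t)) (p.x l)| ≤ M := by
    intro l
    rw [hf, ← Real.norm_eq_abs]
    refine (norm_integral_le_of_norm_le_const (C := M) ?_).trans (by simp)
    filter_upwards [h.mem_ae ht] with a ha using h.bounded.φ_le l _ ha
  have hfe : ∀ l, |p.f (μ₀.map (Θ t)) (p.x l) - p.f (μ₀.map Θinf) (p.x l)|
      ≤ M * meanDist μ₀ Θ Θinf t := by
    intro l
    rw [hf, hf', ← integral_sub (integrable_comp h.compact (h.aemeasurable ht) (h.mem_ae ht)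
      (h.continuousOn_φ l)) (integrable_comp h.compact h.aemeasurable_lim h.lim_mem
      (h.continuousOn_φ l)), meanDist, ← integral_const_mul, ← Real.norm_eq_abs]
    refine norm_integral_le_of_norm_le ((h.integrable_dist ht).norm.const_mul M) ?_
    filter_upwards [h.mem_ae ht, h.lim_mem] with a ha ha'
    exact h.bounded.φ_lip l _ ha _ ha'
  have hdiff := h.bounded.norm_hess_V_sub_le h.regular hint hint_inf hfM hfe
    (integral_nonneg fun _ => norm_nonneg _) (h.mem t ht θ h3) h2
  change _ ≤ defect M μ₀ Θ Θinf θ t at hdiff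
  have hlim : σ * ‖v‖ ^ 2 ≤ inner ℝ v (hess (p.V (μ₀.map Θinf)) (Θinf θ) v) := by
    by_cases hv : v = 0
    · simp [hv]
    · exact (hσ _ h1 v hv).le
  set A := hess (p.V (μ₀.map (Θ t))) (Θ t θ)
  set B := hess (p.V (μ₀.map Θinf)) (Θinf θ)
  have h4 : |inner ℝ v ((A - B) v)| ≤ defect M μ₀ Θ Θinf θ t * ‖v‖ ^ 2 := by
    refine (abs_real_inner_le_norm _ _).trans ?_
    calc ‖v‖ * ‖(A - B) v‖ ≤ ‖v‖ * (defect M μ₀ Θ Θinf θ t * ‖v‖) :=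
          mul_le_mul_of_nonneg_left ((A - B).le_of_opNorm_le hdiff v) (norm_nonneg _)
      _ = _ := by ring
  rw [sub_apply, inner_sub_right] at h4
  linarith [neg_abs_le (inner ℝ v (A v) - inner ℝ v (B v))]

lemma aemeasurable_dist (h : p.ConvergesIn μ₀ Θ Θinf Q M) {a : ℝ} (ha : 0 ≤ a) :
    AEMeasurable (fun z : EuclideanSpace ℝ (Fin k) × ℝ => ‖Θ z.2 z.1 - Θinf z.1‖ₑ)
      (μ₀.prod (volume.restrict (Ioi a))) := by
  have h1 : AEMeasurable (Function.uncurry Θ) ((volume.restrict (Ioi a)).prod μ₀) := by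
    have h2 := h.flow.continuousOn.aemeasurable (μ := volume.prod μ₀)
      (measurableSet_Ici.prod Measure.isClosed_support.measurableSet)
    rw [← Measure.prod_restrict, restrict_eq_self_of_mem_ae Measure.support_mem_ae] at h2
    exact h2.mono_measure (Measure.prod_mono
      (Measure.restrict_mono (fun s hs => ha.trans (le_of_lt hs)) le_rfl) le_rfl)
  have h3 : AEMeasurable (fun z : EuclideanSpace ℝ (Fin k) × ℝ => Θ z.2 z.1)
      (μ₀.prod (volume.restrict (Ioi a))) := h1.prod_swap
  exact (h3.sub (h.aemeasurable_lim.comp_quasiMeasurePreserving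
    Measure.quasiMeasurePreserving_fst)).enorm

lemma aemeasurable_U (h : p.ConvergesIn μ₀ Θ Θinf Q M) {a : ℝ} (ha : 0 ≤ a) :
    AEMeasurable (U Θ Θinf a) μ₀ :=
  (h.aemeasurable_dist ha).lintegral_prod_right'

lemma Ubar_eq (h : p.ConvergesIn μ₀ Θ Θinf Q M) {a : ℝ} (ha : 0 ≤ a) :
    Ubar μ₀ Θ Θinf a = ∫⁻ s in Ioi a, ∫⁻ θ, ‖Θ s θ - Θinf θ‖ₑ ∂μ₀ :=
  lintegral_lintegral_swap (h.aemeasurable_dist ha)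

end ConvergesIn

omit [IsProbabilityMeasure μ₀] in
lemma U_anti {a t : ℝ} (hat : a ≤ t) (θ : EuclideanSpace ℝ (Fin k)) :
    U Θ Θinf t θ ≤ U Θ Θinf a θ := lintegral_mono_set (Ioi_subset_Ioi hat)

omit [IsProbabilityMeasure μ₀] in
lemma Ubar_anti {a t : ℝ} (hat : a ≤ t) : Ubar μ₀ Θ Θinf t ≤ Ubar μ₀ Θ Θinf a :=
  lintegral_mono fun θ => U_anti hat θ

/-- A bound for the total defect met by the path of `θ` after time `t`. -/
def totalDefect (M : ℝ) (μ₀ : Measure (EuclideanSpace ℝ (Fin k)))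
    (Θ : ℝ → EuclideanSpace ℝ (Fin k) → EuclideanSpace ℝ (Fin k))
    (Θinf : EuclideanSpace ℝ (Fin k) → EuclideanSpace ℝ (Fin k))
    (t : ℝ) (θ : EuclideanSpace ℝ (Fin k)) : ℝ :=
  hessLip M * ((U Θ Θinf t θ).toReal + (Ubar μ₀ Θ Θinf t).toReal)

omit [IsProbabilityMeasure μ₀] in
lemma totalDefect_nonneg (t : ℝ) (θ : EuclideanSpace ℝ (Fin k)) :
    0 ≤ totalDefect M μ₀ Θ Θinf t θ :=
  mul_nonneg (hessLip_pos M).le (add_nonneg ENNReal.toReal_nonneg ENNReal.toReal_nonneg)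

namespace ConvergesIn

lemma U_lt_top (h : p.ConvergesIn μ₀ Θ Θinf Q M) {a : ℝ} (ha : 0 ≤ a)
    (hU : Ubar μ₀ Θ Θinf a ≠ ⊤) : ∀ᵐ θ ∂μ₀, U Θ Θinf a θ < ⊤ :=
  ae_lt_top' (h.aemeasurable_U ha) hU

lemma integral_defect_le (h : p.ConvergesIn μ₀ Θ Θinf Q M) {a : ℝ} (ha : 0 ≤ a)
    (hU : Ubar μ₀ Θ Θinf a ≠ ⊤) :
    ∀ᵐ θ ∂μ₀, ∀ t, a ≤ t → ∫ s in a..t, defect M μ₀ Θ Θinf θ s ≤ totalDefect M μ₀ Θ Θinf a θ := by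
  filter_upwards [h.U_lt_top ha hU, Measure.support_mem_ae] with θ hθU hθ t hat
  have hsub : Icc a t ⊆ Ici 0 := fun s hs => ha.trans hs.1
  have hc1 : ContinuousOn (fun s => Θ s θ - Θinf θ) (Icc a t) :=
    ((continuousOn_slice_time h.flow.continuousOn hθ).sub continuousOn_const).mono hsub
  have hc2 : ContinuousOn (meanDist μ₀ Θ Θinf) (Icc a t) := h.continuousOn_meanDist.mono hsub
  have hi1 : IntegrableOn (fun s => Θ s θ - Θinf θ) (Ioc a t) :=
    (hc1.integrableOn_compact isCompact_Icc).mono_set Ioc_subset_Icc_self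
  have hi2 : IntegrableOn (meanDist μ₀ Θ Θinf) (Ioc a t) :=
    (hc2.integrableOn_compact isCompact_Icc).mono_set Ioc_subset_Icc_self
  have e1 : ∫ s in Ioc a t, ‖Θ s θ - Θinf θ‖ ≤ (U Θ Θinf a θ).toReal := by
    rw [integral_norm_eq_lintegral_enorm hi1.1]
    exact ENNReal.toReal_mono hθU.ne (lintegral_mono_set Ioc_subset_Ioi_self)
  have e2 : ∫ s in Ioc a t, meanDist μ₀ Θ Θinf s ≤ (Ubar μ₀ Θ Θinf a).toReal := by
    have hm : ∀ s, 0 ≤ meanDist μ₀ Θ Θinf s := fun s => integral_nonneg fun _ => norm_nonneg _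
    rw [integral_eq_lintegral_of_nonneg_ae (ae_of_all _ hm) hi2.1]
    refine ENNReal.toReal_mono hU ?_
    rw [h.Ubar_eq ha]
    calc ∫⁻ s in Ioc a t, ENNReal.ofReal (meanDist μ₀ Θ Θinf s)
        = ∫⁻ s in Ioc a t, ∫⁻ θ, ‖Θ s θ - Θinf θ‖ₑ ∂μ₀ := by
          refine setLIntegral_congr_fun measurableSet_Ioc fun s hs => ?_
          exact ofReal_integral_norm_eq_lintegral_enorm
            (h.integrable_dist (ha.trans hs.1.le))
      _ ≤ _ := lintegral_mono_set Ioc_subset_Ioi_self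
  rw [intervalIntegral.integral_of_le hat]
  simp only [defect]
  rw [integral_const_mul, integral_add hi1.norm hi2, totalDefect]
  exact mul_le_mul_of_nonneg_left (add_le_add e1 e2) (hessLip_pos M).le

lemma totalDefect_anti (h : p.ConvergesIn μ₀ Θ Θinf Q M) {a : ℝ} (ha : 0 ≤ a)
    (hU : Ubar μ₀ Θ Θinf a ≠ ⊤) :
    ∀ᵐ θ ∂μ₀, ∀ t, a ≤ t → totalDefect M μ₀ Θ Θinf t θ ≤ totalDefect M μ₀ Θ Θinf a θ := by
  filter_upwards [h.U_lt_top ha hU] with θ hθU t hat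
  exact mul_le_mul_of_nonneg_left (add_le_add (ENNReal.toReal_mono hθU.ne (U_anti hat θ))
    (ENNReal.toReal_mono hU (Ubar_anti hat))) (hessLip_pos M).le

lemma aemeasurable_totalDefect (h : p.ConvergesIn μ₀ Θ Θinf Q M) {t : ℝ} (ht : 0 ≤ t) :
    AEMeasurable (totalDefect M μ₀ Θ Θinf t) μ₀ :=
  ((h.aemeasurable_U ht).ennreal_toReal.add_const _).const_mul _

/-- The mean loss factor `∫ (e^{2 D_t} - 1) dμ₀` vanishes in the limit, once it is finite. -/
lemma tendsto_integral_exp_totalDefect (h : p.ConvergesIn μ₀ Θ Θinf Q M) {a : ℝ} (ha : 0 ≤ a)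
    (hU : Ubar μ₀ Θ Θinf a ≠ ⊤)
    (hexp : Integrable (fun θ => Real.exp (2 * totalDefect M μ₀ Θ Θinf a θ)) μ₀) :
    (∀ t, a ≤ t → Integrable (fun θ => Real.exp (2 * totalDefect M μ₀ Θ Θinf t θ)) μ₀) ∧
    Tendsto (fun t => ∫ θ, (Real.exp (2 * totalDefect M μ₀ Θ Θinf t θ) - 1) ∂μ₀) atTop
      (𝓝 0) := by
  have hmeas : ∀ t, a ≤ t → AEStronglyMeasurable
      (fun θ => Real.exp (2 * totalDefect M μ₀ Θ Θinf t θ)) μ₀ := fun t ht =>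
    (((h.aemeasurable_totalDefect (ha.trans ht)).const_mul 2).exp).aestronglyMeasurable
  constructor
  · intro t ht
    refine hexp.mono (hmeas t ht) ?_
    filter_upwards [h.totalDefect_anti ha hU] with θ hθ
    rw [Real.norm_of_nonneg (Real.exp_pos _).le, Real.norm_of_nonneg (Real.exp_pos _).le]
    exact Real.exp_le_exp.2 (by linarith [hθ t ht])
  · have hU0 : Tendsto (fun t => (Ubar μ₀ Θ Θinf t).toReal) atTop (𝓝 0) := by
      have h1 := (ENNReal.tendsto_toReal ENNReal.zero_ne_top).comp
        (tendsto_setLIntegral_Ioi_zero (h.Ubar_eq ha ▸ hU))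
      refine h1.congr' ?_
      filter_upwards [eventually_ge_atTop a] with t ht
      rw [h.Ubar_eq (ha.trans ht)]; rfl
    have := tendsto_integral_filter_of_dominated_convergence (μ := μ₀) (l := atTop)
      (F := fun t θ => Real.exp (2 * totalDefect M μ₀ Θ Θinf t θ) - 1) (f := fun _ => 0)
      (fun θ => Real.exp (2 * totalDefect M μ₀ Θ Θinf a θ)) ?_ ?_ hexp ?_
    · simpa using this
    · filter_upwards [eventually_ge_atTop a] with t ht
      exact (hmeas t ht).sub aestronglyMeasurable_const
    · filter_upwards [eventually_ge_atTop a] with t ht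
      filter_upwards [h.totalDefect_anti ha hU] with θ hθ
      have h1 : 1 ≤ Real.exp (2 * totalDefect M μ₀ Θ Θinf t θ) :=
        Real.one_le_exp (mul_nonneg zero_le_two (totalDefect_nonneg t θ))
      have h2 := Real.exp_le_exp.2 (mul_le_mul_of_nonneg_left (hθ t ht) (zero_le_two (α := ℝ)))
      rw [Real.norm_of_nonneg (by linarith)]
      linarith
    · filter_upwards [h.U_lt_top ha hU] with θ hθ
      have h1 : Tendsto (fun t => (U Θ Θinf t θ).toReal) atTop (𝓝 0) :=
        (ENNReal.tendsto_toReal ENNReal.zero_ne_top).comp (tendsto_setLIntegral_Ioi_zero hθ.ne)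
      have h2 : Tendsto (fun t => totalDefect M μ₀ Θ Θinf t θ) atTop (𝓝 0) := by
        simpa [totalDefect] using (h1.add hU0).const_mul (hessLip M)
      simpa using ((h2.const_mul 2).rexp).sub_const 1

end ConvergesIn

end Flow

end Problem

/-! ### The energy inequality for the fluctuations -/

namespace Problem

namespace ConvergesIn

variable {k d n : ℕ} {p : Problem k d n} {μ₀ : Measure (EuclideanSpace ℝ (Fin k))}
  [IsProbabilityMeasure μ₀]
  {Θ : ℝ → EuclideanSpace ℝ (Fin k) → EuclideanSpace ℝ (Fin k)}
  {Θinf : EuclideanSpace ℝ (Fin k) → EuclideanSpace ℝ (Fin k)}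
  {Q : Set (EuclideanSpace ℝ (Fin k))} {M : ℝ}
  {S : Type*} [MeasurableSpace S] {P : Measure S} [IsProbabilityMeasure P]
  {ω₀ : Lp ℝ 2 μ₀ →ₗ[ℝ] Lp ℝ 2 P}
  {T : ℝ → EuclideanSpace ℝ (Fin k) → Lp (EuclideanSpace ℝ (Fin k)) 2 P}

omit [IsProbabilityMeasure P] in
lemma tendsto_norm_sq_sampling (h : p.ConvergesIn μ₀ Θ Θinf Q M)
    (hω : IsGaussianFluctuation P μ₀ ω₀) :
    Tendsto (fun t => ∑ l, (n : ℝ)⁻¹ * ‖p.sampling Θ ω₀ t l‖ ^ 2) atTop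
      (𝓝 (p.monteCarloBound (μ₀.map Θinf))) := by
  have hφ := h.continuousOn_φ
  have hlimφ : ∀ l, ∀ᵐ θ ∂μ₀,
      Tendsto (fun t => p.φ (Θ t θ) (p.x l)) atTop (𝓝 (p.φ (Θinf θ) (p.x l))) := by
    intro l
    filter_upwards [h.tendsto, h.lim_mem] with θ hθ hQ
    exact (h.regular.continuousAt_φ l
      (h.bounded.closure_subset (subset_closure hQ))).tendsto.comp hθ
  have hlim : p.monteCarloBound (μ₀.map Θinf) = ∑ l, (n : ℝ)⁻¹ *
      ((∫ θ, p.φ (Θinf θ) (p.x l) ^ 2 ∂μ₀) - (∫ θ, p.φ (Θinf θ) (p.x l) ∂μ₀) ^ 2) := by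
    simp only [monteCarloBound, dataSqNorm, dataAvg, f]
    rw [integral_const_mul, integral_finsetSum, ← mul_sub, ← Finset.sum_sub_distrib,
      Finset.mul_sum]
    · refine Finset.sum_congr rfl fun l _ => ?_
      rw [integral_map_eq h.compact h.aemeasurable_lim h.lim_mem (u := fun a => p.φ a (p.x l) ^ 2)
        ((hφ l).pow 2), integral_map_eq h.compact h.aemeasurable_lim h.lim_mem (hφ l)]
    · exact fun l _ => integrable_map h.compact h.aemeasurable_lim h.lim_mem ((hφ l).pow 2)
  rw [hlim]
  have hev : (fun t => ∑ l, (n : ℝ)⁻¹ * ((∫ θ, p.φ (Θ t θ) (p.x l) ^ 2 ∂μ₀)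
      - (∫ θ, p.φ (Θ t θ) (p.x l) ∂μ₀) ^ 2))
      =ᶠ[atTop] fun t => ∑ l, (n : ℝ)⁻¹ * ‖p.sampling Θ ω₀ t l‖ ^ 2 := by
    filter_upwards [eventually_ge_atTop 0] with t ht
    refine Finset.sum_congr rfl fun l _ => ?_
    rw [sampling, norm_sq_noiseInt hω (memLp_φ_flow h.regular h.compact_support h.flow ht l)]
  refine Tendsto.congr' hev ?_
  refine tendsto_finsetSum _ fun l _ => Tendsto.const_mul _ (Tendsto.sub ?_ (Tendsto.pow ?_ 2))
  · refine tendsto_integral_filter_of_dominated_convergence (fun _ => M ^ 2) ?_ ?_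
      (integrable_const _) ?_
    · filter_upwards [eventually_ge_atTop 0] with t ht
      exact (integrable_comp h.compact (h.aemeasurable ht) (h.mem_ae ht) ((hφ l).pow 2)).1
    · filter_upwards [eventually_ge_atTop 0] with t ht
      filter_upwards [h.mem_ae ht] with θ hθ
      rw [norm_pow, Real.norm_eq_abs]
      exact pow_le_pow_left₀ (abs_nonneg _) (h.bounded.φ_le l _ hθ) 2
    · filter_upwards [hlimφ l] with θ hθ using hθ.pow 2
  · refine tendsto_integral_filter_of_dominated_convergence (fun _ => M) ?_ ?_
      (integrable_const _) (hlimφ l)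
    · filter_upwards [eventually_ge_atTop 0] with t ht
      exact (integrable_comp h.compact (h.aemeasurable ht) (h.mem_ae ht) (hφ l)).1
    · filter_upwards [eventually_ge_atTop 0] with t ht
      filter_upwards [h.mem_ae ht] with θ hθ
      exact h.bounded.φ_le l _ hθ

/-- Averaging the energy inequality over the particles: the total work of the force is bounded up
to a constant by a small multiple of `∫ 𝔼 ‖g_t‖² dt`. -/
lemma integral_work_le (h : p.ConvergesIn μ₀ Θ Θinf Q M) (hω : IsGaussianFluctuation P μ₀ ω₀)
    (hT : p.IsFlowFluctuation Θ ω₀ T) {σ : ℝ} (hσ0 : 0 < σ)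
    (hσ : ∀ θ ∈ (μ₀.map Θinf).support, ∀ v : EuclideanSpace ℝ (Fin k), v ≠ 0 →
      σ * ‖v‖ ^ 2 < inner ℝ v (hess (p.V (μ₀.map Θinf)) θ v))
    {a : ℝ} (ha : 0 ≤ a) (hU : Ubar μ₀ Θ Θinf a ≠ ⊤)
    (hexp : Integrable (fun θ => Real.exp (2 * totalDefect M μ₀ Θ Θinf a θ)) μ₀) :
    ∃ C, 0 ≤ C ∧ ∀ τ, a ≤ τ →
      ∫ t in a..τ, (∫ θ, inner ℝ (T t θ) (p.forcing Θ ω₀ T t θ) ∂μ₀)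
        ≤ C + (M ^ 2 / (4 * σ) * ∫ θ, (Real.exp (2 * totalDefect M μ₀ Θ Θinf a θ) - 1) ∂μ₀)
          * ∫ t in a..τ, p.meanSq Θ ω₀ T t := by
  have hp := h.regular
  have hK := h.compact_support
  have hfc := continuousOn_forcing hp hK h.flow hT hω
  have hTint : Integrable (fun θ => Real.exp (2 * totalDefect M μ₀ Θ Θinf a θ) * ‖T a θ‖ ^ 2)
      μ₀ := by
    have hTc := continuousOn_slice hT.continuousOn ha
    obtain ⟨R, hR⟩ := hK.exists_bound_of_continuousOn (hTc.norm.pow 2)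
    refine hexp.mul_bdd (c := R) (integrable_of_continuousOn_compact hK Measure.support_mem_ae
      (hTc.norm.pow 2)).1 ?_
    filter_upwards [Measure.support_mem_ae] with θ hθ using hR θ hθ
  refine ⟨∫ θ, 2⁻¹ * (Real.exp (2 * totalDefect M μ₀ Θ Θinf a θ) * ‖T a θ‖ ^ 2) ∂μ₀,
    integral_nonneg fun θ => by positivity, fun τ hτ => ?_⟩
  obtain ⟨hint, hswap⟩ := integral_intervalIntegral_swap_of_compact hK Measure.support_mem_ae
    (h := fun t θ => inner ℝ (T t θ) (p.forcing Θ ω₀ T t θ)) (hT.continuousOn.inner hfc) ha hτ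
  rw [hswap]
  have hpt : ∀ᵐ θ ∂μ₀, ∫ t in a..τ, inner ℝ (T t θ) (p.forcing Θ ω₀ T t θ)
      ≤ 2⁻¹ * (Real.exp (2 * totalDefect M μ₀ Θ Θinf a θ) * ‖T a θ‖ ^ 2)
        + (Real.exp (2 * totalDefect M μ₀ Θ Θinf a θ) - 1) * (M ^ 2 / (4 * σ)
          * ∫ t in a..τ, p.meanSq Θ ω₀ T t) := by
    filter_upwards [h.curvature_along_flow hσ, h.integral_defect_le ha hU,
      Measure.support_mem_ae] with θ hcurv hdef hθ
    have := integral_inner_forcing_le ha hτ hσ0 (m := M ^ 2) (G := p.meanSq Θ ω₀ T)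
      (δ := defect M μ₀ Θ Θinf θ) (D₀ := totalDefect M μ₀ Θ Θinf a θ)
      (b := fun t => p.forcing Θ ω₀ T t θ) (hT.ode θ hθ) (continuousOn_slice_time hfc hθ)
      (continuousOn_meanSq hp hK h.flow hT hω) (h.continuousOn_defect hθ)
      (fun t ht => norm_sq_forcing_le hp.n_pos h.bounded (h.mem t ht θ hθ))
      (fun t => defect_nonneg θ t) hdef ?_
    · refine this.trans (le_of_eq ?_)
      ring
    · intro t hat
      have ht : 0 ≤ t := ha.trans hat
      rw [← interaction_add_noise_eq_forcing hp hK h.flow hT ht hθ, sub_sub, sub_add_cancel,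
        inner_neg_right, neg_mul]
      exact neg_le_neg (mul_norm_sq_le_inner_compLp (hcurv t ht) _)
  have hint1 : Integrable (fun θ => Real.exp (2 * totalDefect M μ₀ Θ Θinf a θ) - 1) μ₀ :=
    hexp.sub (integrable_const 1)
  refine (integral_mono_ae hint ((hTint.const_mul _).add (hint1.mul_const _)) hpt).trans
    (le_of_eq ?_)
  simp only [Pi.add_apply]
  rw [integral_add (hTint.const_mul _) (hint1.mul_const _), integral_mul_const]
  ring

/-- Absorbing the work inequality: after a time `a` past which the Monte-Carlo variance is at most
`B`, the fluctuations `𝔼 ‖g_t‖²` are on average at most `B`, up to the factor `1 - 2 ε`. -/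
lemma integral_meanSq_le (h : p.ConvergesIn μ₀ Θ Θinf Q M) (hω : IsGaussianFluctuation P μ₀ ω₀)
    (hT : p.IsFlowFluctuation Θ ω₀ T) {σ : ℝ} (hσ0 : 0 < σ)
    (hσ : ∀ θ ∈ (μ₀.map Θinf).support, ∀ v : EuclideanSpace ℝ (Fin k), v ≠ 0 →
      σ * ‖v‖ ^ 2 < inner ℝ v (hess (p.V (μ₀.map Θinf)) θ v))
    {a : ℝ} (ha : 0 ≤ a) (hU : Ubar μ₀ Θ Θinf a ≠ ⊤)
    (hexp : Integrable (fun θ => Real.exp (2 * totalDefect M μ₀ Θ Θinf a θ)) μ₀) {B : ℝ}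
    (hB : ∀ t, a ≤ t → ∑ l, (n : ℝ)⁻¹ * ‖p.sampling Θ ω₀ t l‖ ^ 2 ≤ B) :
    ∃ C, 0 ≤ C ∧ ∀ τ, a ≤ τ →
      (1 - 2 * (M ^ 2 / (4 * σ) *
        ∫ θ, (Real.exp (2 * totalDefect M μ₀ Θ Θinf a θ) - 1) ∂μ₀))
        * ∫ t in a..τ, p.meanSq Θ ω₀ T t ≤ C + B * (τ - a) := by
  obtain ⟨C, hC0, hC⟩ := h.integral_work_le hω hT hσ0 hσ ha hU hexp
  refine ⟨2 * C, by positivity, fun τ hτ => ?_⟩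
  have hsub : uIcc a τ ⊆ Ici 0 := by
    rw [uIcc_of_le hτ]
    exact fun s hs => ha.trans hs.1
  have hGc := continuousOn_meanSq h.regular h.compact_support h.flow hT hω
  have hGi : IntervalIntegrable (p.meanSq Θ ω₀ T) volume a τ := (hGc.mono hsub).intervalIntegrable
  have hWc : ContinuousOn (fun t => ∫ θ, inner ℝ (T t θ) (p.forcing Θ ω₀ T t θ) ∂μ₀) (Ici 0) :=
    continuousOn_integral_of_compact h.compact_support Measure.support_mem_ae
      (hT.continuousOn.inner (continuousOn_forcing h.regular h.compact_support h.flow hT hω))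
  have hlow : ∫ t in a..τ, (2⁻¹ * p.meanSq Θ ω₀ T t - 2⁻¹ * B)
      ≤ ∫ t in a..τ, (∫ θ, inner ℝ (T t θ) (p.forcing Θ ω₀ T t θ) ∂μ₀) := by
    refine intervalIntegral.integral_mono_on hτ
      ((hGi.const_mul _).sub intervalIntegrable_const) (hWc.mono hsub).intervalIntegrable ?_
    intro t ht
    rw [integral_inner_forcing h.regular h.compact_support h.flow hT (ha.trans ht.1)]
    have h1 : 2⁻¹ * p.meanSq Θ ω₀ T t
        - 2⁻¹ * ∑ l, (n : ℝ)⁻¹ * ‖p.sampling Θ ω₀ t l‖ ^ 2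
        ≤ ∑ l, (n : ℝ)⁻¹ * inner ℝ (p.g Θ ω₀ T t (p.x l) - p.sampling Θ ω₀ t l)
          (p.g Θ ω₀ T t (p.x l)) := by
      rw [meanSq, Finset.mul_sum, Finset.mul_sum, ← Finset.sum_sub_distrib]
      refine Finset.sum_le_sum fun l _ => ?_
      have h2 := norm_sub_sq_real (p.g Θ ω₀ T t (p.x l)) (p.sampling Θ ω₀ t l)
      have h3 : 0 ≤ ‖p.g Θ ω₀ T t (p.x l) - p.sampling Θ ω₀ t l‖ ^ 2 := sq_nonneg _
      -- `⟪g - ḡ, g⟫ = (‖g‖² - ‖ḡ‖² + ‖g - ḡ‖²) / 2`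
      have h4 : 2⁻¹ * (‖p.g Θ ω₀ T t (p.x l)‖ ^ 2 - ‖p.sampling Θ ω₀ t l‖ ^ 2)
          ≤ inner ℝ (p.g Θ ω₀ T t (p.x l) - p.sampling Θ ω₀ t l) (p.g Θ ω₀ T t (p.x l)) := by
        rw [inner_sub_left, real_inner_self_eq_norm_sq, real_inner_comm]
        linarith
      have h5 := mul_le_mul_of_nonneg_left h4 (show (0 : ℝ) ≤ (n : ℝ)⁻¹ by positivity)
      linarith
    have h6 := hB t ht.1
    linarith
  rw [intervalIntegral.integral_sub (hGi.const_mul _) intervalIntegrable_const,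
    intervalIntegral.integral_const_mul, intervalIntegral.integral_const, smul_eq_mul] at hlow
  have := hlow.trans (hC τ hτ)
  linarith

/-- The long-time average of the fluctuations is bounded by the Monte-Carlo variance of the limit,
whenever the defect has a finite exponential moment after some time `a`. -/
theorem limsup_average_le (h : p.ConvergesIn μ₀ Θ Θinf Q M) (hω : IsGaussianFluctuation P μ₀ ω₀)
    (hT : p.IsFlowFluctuation Θ ω₀ T) (hcurv : p.CurvatureBound (μ₀.map Θinf))
    {a : ℝ} (ha : 0 ≤ a) (hU : Ubar μ₀ Θ Θinf a ≠ ⊤)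
    (hexp : Integrable (fun θ => Real.exp (2 * totalDefect M μ₀ Θ Θinf a θ)) μ₀) :
    limsup (fun τ : ℝ => (ENNReal.ofReal τ)⁻¹ *
        ∫⁻ t in Ioc 0 τ, p.expSqNorm (p.g Θ ω₀ T t)) atTop
      ≤ ENNReal.ofReal (p.monteCarloBound (μ₀.map Θinf)) := by
  obtain ⟨σ, hσ0, hσ⟩ := hcurv
  set B := p.monteCarloBound (μ₀.map Θinf) with hBdef
  have hmc := h.tendsto_norm_sq_sampling hω
  have hB0 : 0 ≤ B := ge_of_tendsto' hmc fun t => Finset.sum_nonneg fun _ _ => by positivity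
  have hGc := continuousOn_meanSq h.regular h.compact_support h.flow hT hω
  have hGi : ∀ {s t : ℝ}, 0 ≤ s → s ≤ t → IntervalIntegrable (p.meanSq Θ ω₀ T) volume s t :=
    fun hs hst => (hGc.mono (by
      rw [uIcc_of_le hst]
      exact fun u hu => hs.trans hu.1)).intervalIntegrable
  -- it suffices to bound the averages eventually by every number above `B`
  suffices key : ∀ ρ, B < ρ → ∀ᶠ τ : ℝ in atTop, τ⁻¹ * ∫ t in (0 : ℝ)..τ, p.meanSq Θ ω₀ T t ≤ ρ by
    refine ge_of_tendsto (x := 𝓝[>] B)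
      ((ENNReal.continuous_ofReal.tendsto B).mono_left nhdsWithin_le_nhds) ?_
    filter_upwards [self_mem_nhdsWithin] with ρ hρ
    refine limsup_le_of_le (by isBoundedDefault) ?_
    filter_upwards [key ρ hρ, eventually_gt_atTop 0] with τ hτ hτ0
    have e1 : ∫⁻ t in Ioc 0 τ, p.expSqNorm (p.g Θ ω₀ T t)
        = ENNReal.ofReal (∫ t in (0 : ℝ)..τ, p.meanSq Θ ω₀ T t) := by
      simp_rw [expSqNorm_eq h.regular.n_pos]
      rw [intervalIntegral.integral_of_le hτ0.le, ofReal_integral_eq_lintegral_ofReal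
        (hGi le_rfl hτ0.le).1 (ae_of_all _ fun t => meanSq_nonneg t)]
    rw [e1, ← ENNReal.ofReal_inv_of_pos hτ0, ← ENNReal.ofReal_mul (inv_nonneg.2 hτ0.le)]
    exact ENNReal.ofReal_le_ofReal hτ
  intro ρ hρ
  -- one third of the gap each for `ḡ`, for the factor `1 - 2 ε`, and for the initial energies
  set η := (ρ - B) / 3 with hη
  have hη0 : 0 < η := by rw [hη]; linarith
  obtain ⟨hexpt, hε⟩ := h.tendsto_integral_exp_totalDefect ha hU hexp
  set E : ℝ → ℝ := fun t => M ^ 2 / (4 * σ) *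
    ∫ θ, (Real.exp (2 * totalDefect M μ₀ Θ Θinf t θ) - 1) ∂μ₀ with hE
  have hE0 : Tendsto E atTop (𝓝 0) := by simpa using hε.const_mul (M ^ 2 / (4 * σ))
  have hEnn : ∀ t, 0 ≤ E t := fun t => by
    refine mul_nonneg (by positivity) (integral_nonneg fun θ => ?_)
    have : 1 ≤ Real.exp (2 * totalDefect M μ₀ Θ Θinf t θ) :=
      Real.one_le_exp (mul_nonneg zero_le_two (totalDefect_nonneg t θ))
    simpa using this
  have hE1 : ∀ᶠ t in atTop, 2 * E t * ρ ≤ η :=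
    ((hE0.const_mul 2).mul_const ρ).eventually_le_const (by simpa using hη0)
  have hE2 : ∀ᶠ t in atTop, E t ≤ 1 / 4 := hE0.eventually_le_const (by norm_num)
  have hB1 := eventually_forall_ge_atTop.2 (hmc.eventually_le_const (show B < B + η by linarith))
  obtain ⟨b, hb1, hb2, hb3, hab⟩ := (hE1.and (hE2.and (hB1.and (eventually_ge_atTop a)))).exists
  have hb0 : 0 ≤ b := ha.trans hab
  obtain ⟨C, hC0, hC⟩ := h.integral_meanSq_le hω hT hσ0 hσ hb0
    (ne_top_of_le_ne_top hU (Ubar_anti hab)) (hexpt b hab) hb3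
  change ∀ τ, b ≤ τ → (1 - 2 * E b) * _ ≤ _ at hC
  set A := ∫ t in (0 : ℝ)..b, p.meanSq Θ ω₀ T t with hA
  have hA0 : 0 ≤ A := intervalIntegral.integral_nonneg hb0 fun t _ => meanSq_nonneg t
  filter_upwards [eventually_ge_atTop b, eventually_gt_atTop 0,
    eventually_ge_atTop ((A + C) / η)] with τ hτb hτ0 hτ
  have hsplit := intervalIntegral.integral_add_adjacent_intervals (hGi le_rfl hb0) (hGi hb0 hτb)
  rw [inv_mul_le_iff₀ hτ0, ← hsplit]
  have h1 := hC τ hτb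
  have h2 : A + C ≤ η * τ := by rwa [div_le_iff₀' hη0] at hτ
  have h3 : 0 < 1 - 2 * E b := by linarith
  have h4 : (1 - 2 * E b) * A ≤ A := mul_le_of_le_one_left hA0 (by linarith [hEnn b])
  have h5 : 2 * E b * ρ * τ ≤ η * τ := mul_le_mul_of_nonneg_right hb1 hτ0.le
  have h6 : 0 ≤ (B + η) * b := by positivity
  have h7 : ρ = B + 3 * η := by rw [hη]; ring
  have h8 : ρ * τ = B * τ + 3 * (η * τ) := by rw [h7]; ring
  refine le_of_mul_le_mul_left ?_ h3
  rw [← hA]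
  nlinarith

end ConvergesIn

end Problem

/-! ### The two rate conditions give an exponential moment of the defect -/

section Rates

variable {k : ℕ} {μ₀ : Measure (EuclideanSpace ℝ (Fin k))}
  {Θ : ℝ → EuclideanSpace ℝ (Fin k) → EuclideanSpace ℝ (Fin k)}
  {Θinf : EuclideanSpace ℝ (Fin k) → EuclideanSpace ℝ (Fin k)}

lemma exp_mul_coe_top {c : ℝ} (hc : 0 < c) :
    EReal.exp ((c : EReal) * ((⊤ : ℝ≥0∞) : EReal)) = ⊤ := by
  rw [EReal.coe_ennreal_top, EReal.coe_mul_top_of_pos hc, EReal.exp_top]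

lemma exp_mul_coe_add {c : ℝ} {u v : ℝ≥0∞} (hu : u ≠ ⊤) (hv : v ≠ ⊤) :
    EReal.exp ((c : EReal) * ((u + v : ℝ≥0∞) : EReal))
      = ENNReal.ofReal (Real.exp (c * (u.toReal + v.toReal))) := by
  lift u to ℝ≥0 using hu
  lift v to ℝ≥0 using hv
  rw [← EReal.exp_coe]
  congr 1

/-- Weighted integrability bounds an exponential moment of `U_t` at some time: where `U_t ≥ 1`, the
weight `U_t²` may be dropped. -/
lemma WeightedIntegrability.exists_exp_moment [IsProbabilityMeasure μ₀] {c : ℝ} (hc : 0 < c)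
    (hw : WeightedIntegrability μ₀ Θ Θinf c) :
    ∃ a, 0 ≤ a ∧ Ubar μ₀ Θ Θinf a ≠ ⊤ ∧
      ∫⁻ θ, ENNReal.ofReal
        (Real.exp (c * ((U Θ Θinf a θ).toReal + (Ubar μ₀ Θ Θinf a).toReal))) ∂μ₀ ≠ ⊤ := by
  obtain ⟨a, ha, hfin⟩ : ∃ a : ℝ, 0 < a ∧ ∫⁻ θ, (‖Θ a θ - Θinf θ‖ₑ + U Θ Θinf a θ ^ 2) *
      EReal.exp ((c : EReal) * ((U Θ Θinf a θ + Ubar μ₀ Θ Θinf a : ℝ≥0∞) : EReal)) ∂μ₀ ≠ ⊤ := by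
    by_contra! hcon
    refine hw.ne (top_le_iff.1 ?_)
    calc (⊤ : ℝ≥0∞) = ∫⁻ _ in Ioi (0 : ℝ), ⊤ := by simp
      _ ≤ _ := setLIntegral_mono' measurableSet_Ioi fun t ht => (hcon t ht).ge
  -- if `Ubar = ⊤`, the weight is `⊤` everywhere, so that the integrand dominates `U`
  have hU : Ubar μ₀ Θ Θinf a ≠ ⊤ := by
    intro htop
    refine hfin (top_le_iff.1 (htop.ge.trans (lintegral_mono fun θ => ?_)))
    simp only [htop, add_top]
    rw [exp_mul_coe_top hc]
    rcases eq_or_ne (U Θ Θinf a θ) 0 with h0 | h0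
    · simp [h0]
    · rw [ENNReal.mul_top (by simp [h0])]
      exact le_top
  refine ⟨a, ha.le, hU, ne_top_of_le_ne_top (b := ENNReal.ofReal
    (Real.exp (c * (1 + (Ubar μ₀ Θ Θinf a).toReal)))
      + ∫⁻ θ, (‖Θ a θ - Θinf θ‖ₑ + U Θ Θinf a θ ^ 2) *
      EReal.exp ((c : EReal) * ((U Θ Θinf a θ + Ubar μ₀ Θ Θinf a : ℝ≥0∞) : EReal)) ∂μ₀)
    (ENNReal.add_ne_top.2 ⟨ENNReal.ofReal_ne_top, hfin⟩) ?_⟩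
  have hconst : ENNReal.ofReal (Real.exp (c * (1 + (Ubar μ₀ Θ Θinf a).toReal)))
      = ∫⁻ _, ENNReal.ofReal (Real.exp (c * (1 + (Ubar μ₀ Θ Θinf a).toReal))) ∂μ₀ := by simp
  rw [hconst, ← lintegral_add_left measurable_const]
  refine lintegral_mono fun θ => ?_
  by_cases h1 : (U Θ Θinf a θ).toReal ≤ 1
  · refine le_add_right (ENNReal.ofReal_le_ofReal (Real.exp_le_exp.2 ?_))
    gcongr
  · have htop : U Θ Θinf a θ ≠ ⊤ := fun h => h1 (by simp [h])
    have hone : 1 ≤ U Θ Θinf a θ := by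
      rw [← ENNReal.ofReal_toReal htop, ← ENNReal.ofReal_one]
      exact ENNReal.ofReal_le_ofReal (not_le.1 h1).le
    refine le_add_left ?_
    rw [exp_mul_coe_add htop hU]
    exact le_mul_of_one_le_left' (le_add_left (one_le_pow₀ hone))

namespace UniformRate

lemma U_le (hr : UniformRate μ₀ Θ Θinf) :
    ∃ a, 0 ≤ a ∧ ∃ R : ℝ≥0∞, R ≠ ⊤ ∧ ∀ θ ∈ μ₀.support, U Θ Θinf a θ ≤ R := by
  obtain ⟨α, hα, κ, t₁, ht₁, h⟩ := hr
  refine ⟨t₁, ht₁.le, ∫⁻ s in Ioi t₁, ENNReal.ofReal (κ * s ^ (-α)), ?_, fun θ hθ => ?_⟩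
  · have := ((integrableOn_Ioi_rpow_of_lt (show -α < -1 by linarith) ht₁).const_mul κ)
    exact (ne_of_lt this.lintegral_lt_top)
  · refine setLIntegral_mono' measurableSet_Ioi fun s hs => ?_
    rw [← ofReal_norm]
    exact ENNReal.ofReal_le_ofReal (h s (le_of_lt hs) θ hθ)

lemma eventually_dist_le (hr : UniformRate μ₀ Θ Θinf) {ε : ℝ} (hε : 0 < ε) :
    ∀ᶠ t in atTop, ∀ θ ∈ μ₀.support, dist (Θ t θ) (Θinf θ) ≤ ε := by
  obtain ⟨α, hα, κ, t₁, ht₁, h⟩ := hr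
  have h1 : Tendsto (fun t : ℝ => κ * t ^ (-α)) atTop (𝓝 0) := by
    simpa using (tendsto_rpow_neg_atTop (show 0 < α by linarith)).const_mul κ
  filter_upwards [h1.eventually_le_const hε, eventually_ge_atTop t₁] with t ht ht' θ hθ
  rw [dist_eq_norm]
  exact (h t ht' θ hθ).trans ht

lemma continuousOn_lim (hr : UniformRate μ₀ Θ Θinf)
    (hΘ : ContinuousOn (Function.uncurry Θ) (Ici 0 ×ˢ μ₀.support)) :
    ContinuousOn Θinf μ₀.support := by
  have hunif : TendstoUniformlyOn Θ Θinf atTop μ₀.support := by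
    rw [Metric.tendstoUniformlyOn_iff]
    intro ε hε
    filter_upwards [hr.eventually_dist_le (half_pos hε)] with t ht θ hθ
    rw [dist_comm]
    exact (ht θ hθ).trans_lt (half_lt_self hε)
  refine hunif.continuousOn (Eventually.frequently ?_)
  filter_upwards [eventually_ge_atTop 0] with t ht
  exact continuousOn_slice hΘ ht

/-- Uniform convergence makes the set of visited positions relatively compact in any set which
contains the visited positions and the limits: late positions are close to the compact set of
limits. -/
lemma closure_trajectories (hr : UniformRate μ₀ Θ Θinf) (hK : IsCompact μ₀.support)
    (hΘ : ContinuousOn (Function.uncurry Θ) (Ici 0 ×ˢ μ₀.support)) :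
    IsCompact (closure (trajectories μ₀ Θ)) ∧
      closure (trajectories μ₀ Θ) ⊆ trajectories μ₀ Θ ∪ Θinf '' μ₀.support := by
  have hKinf : IsCompact (Θinf '' μ₀.support) := hK.image_of_continuousOn (hr.continuousOn_lim hΘ)
  have hpart : ∀ N : ℝ, IsCompact (Function.uncurry Θ '' (Icc 0 N ×ˢ μ₀.support)) := fun N =>
    (isCompact_Icc.prod hK).image_of_continuousOn
      (hΘ.mono (prod_mono (fun s hs => hs.1) le_rfl))
  have hcover : ∀ ε : ℝ, 0 < ε → ∃ N : ℝ, closure (trajectories μ₀ Θ)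
      ⊆ Function.uncurry Θ '' (Icc 0 N ×ˢ μ₀.support) ∪ Metric.cthickening ε (Θinf '' μ₀.support) := by
    intro ε hε
    obtain ⟨N, hN⟩ := eventually_atTop.1 (hr.eventually_dist_le hε)
    refine ⟨N, closure_minimal ?_ ((hpart N).isClosed.union Metric.isClosed_cthickening)⟩
    rintro _ ⟨t, ht, θ, hθ, rfl⟩
    rcases le_total t N with h | h
    · exact Or.inl ⟨(t, θ), ⟨⟨ht, h⟩, hθ⟩, rfl⟩
    · exact Or.inr (Metric.mem_cthickening_of_dist_le _ _ _ _ (mem_image_of_mem _ hθ)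
        (hN t h θ hθ))
  constructor
  · obtain ⟨N, hN⟩ := hcover 1 one_pos
    exact ((hpart N).union hKinf.cthickening).of_isClosed_subset isClosed_closure hN
  · intro y hy
    by_cases hyt : y ∈ trajectories μ₀ Θ
    · exact Or.inl hyt
    · right
      rw [← hKinf.isClosed.closure_eq, Metric.closure_eq_iInter_cthickening]
      simp only [mem_iInter]
      intro ε hε
      obtain ⟨N, hN⟩ := hcover ε hε
      rcases hN hy with ⟨z, hz, rfl⟩ | h
      · exact (hyt ⟨z.1, hz.1.1, z.2, hz.2, rfl⟩).elim
      · exact h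

end UniformRate

end Rates

namespace Problem

variable {k d n : ℕ} {p : Problem k d n} {μ₀ : Measure (EuclideanSpace ℝ (Fin k))}
  [IsProbabilityMeasure μ₀]
  {Θ : ℝ → EuclideanSpace ℝ (Fin k) → EuclideanSpace ℝ (Fin k)}
  {Θinf : EuclideanSpace ℝ (Fin k) → EuclideanSpace ℝ (Fin k)} {M : ℝ}

omit [IsProbabilityMeasure μ₀] in
lemma BoundedBy.convergesIn (hB : p.BoundedBy (trajectories μ₀ Θ) M) (hp : p.Regular)
    (hK : IsCompact μ₀.support) (hΘ : p.IsCharFlow μ₀ Θ)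
    (hlim : ∀ᵐ θ ∂μ₀, Tendsto (fun t => Θ t θ) atTop (𝓝 (Θinf θ))) :
    p.ConvergesIn μ₀ Θ Θinf (_root_.closure (trajectories μ₀ Θ)) M where
  regular := hp
  flow := hΘ
  compact_support := hK
  compact := hB.isCompact_closure
  bounded := hB.closure hp
  mem t ht θ hθ := subset_closure ⟨t, ht, θ, hθ, rfl⟩
  tendsto := hlim

/-- Under either rate condition, the flow stays in a compact set and its defect has a finite
exponential moment after some time. -/
lemma exists_convergesIn (hp : p.Regular) (hK : IsCompact μ₀.support) (hΘ : p.IsCharFlow μ₀ Θ)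
    (hinf : ∀ θ ∈ μ₀.support, Θinf θ ∈ p.D)
    (hlim : ∀ᵐ θ ∂μ₀, Tendsto (fun t => Θ t θ) atTop (𝓝 (Θinf θ)))
    (hrate : UniformRate μ₀ Θ Θinf ∨ ∃ M : ℝ, p.BoundedBy (trajectories μ₀ Θ) M ∧
      WeightedIntegrability μ₀ Θ Θinf (2 * hessLip M)) :
    ∃ M, p.ConvergesIn μ₀ Θ Θinf (closure (trajectories μ₀ Θ)) M ∧
      ∃ a, 0 ≤ a ∧ Ubar μ₀ Θ Θinf a ≠ ⊤ ∧
        Integrable (fun θ => Real.exp (2 * totalDefect M μ₀ Θ Θinf a θ)) μ₀ := by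
  rcases hrate with hr | ⟨M, hB, hw⟩
  · obtain ⟨hcpt, hsub⟩ := hr.closure_trajectories hK hΘ.continuousOn
    have hsubD : closure (trajectories μ₀ Θ) ⊆ p.D := by
      refine hsub.trans (union_subset ?_ ?_)
      · rintro _ ⟨t, ht, θ, hθ, rfl⟩
        exact hΘ.mem_D t ht θ hθ
      · rintro _ ⟨θ, hθ, rfl⟩
        exact hinf θ hθ
    obtain ⟨M, hB⟩ := hp.exists_boundedBy hcpt hsubD
    have hconv := (hB.mono subset_closure).convergesIn hp hK hΘ hlim
    obtain ⟨a, ha, R, hR, hUR⟩ := hr.U_le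
    have hU : Ubar μ₀ Θ Θinf a ≤ R := by
      calc Ubar μ₀ Θ Θinf a ≤ ∫⁻ _, R ∂μ₀ := by
            refine lintegral_mono_ae ?_
            filter_upwards [Measure.support_mem_ae] with θ hθ using hUR θ hθ
        _ = R := by simp
    refine ⟨M, hconv, a, ha, ne_top_of_le_ne_top hR hU, ?_⟩
    refine Integrable.of_bound (C := Real.exp (2 * (hessLip M * (R.toReal + R.toReal))))
      (((hconv.aemeasurable_totalDefect ha).const_mul 2).exp).aestronglyMeasurable ?_
    filter_upwards [Measure.support_mem_ae] with θ hθ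
    rw [Real.norm_of_nonneg (Real.exp_pos _).le, totalDefect]
    have h0 := (hessLip_pos M).le
    have h1 := ENNReal.toReal_mono hR (hUR θ hθ)
    have h2 := ENNReal.toReal_mono hR hU
    gcongr
  · have hconv := hB.convergesIn hp hK hΘ hlim
    obtain ⟨a, ha, hU, hexp⟩ := hw.exists_exp_moment (mul_pos two_pos (hessLip_pos M))
    refine ⟨M, hconv, a, ha, hU, ?_⟩
    refine (lintegral_ofReal_ne_top_iff_integrable
      (((hconv.aemeasurable_totalDefect ha).const_mul 2).exp).aestronglyMeasurable
      (ae_of_all _ fun θ => (Real.exp_pos _).le)).1 ?_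
    simpa only [totalDefect, ← mul_assoc] using hexp

end Problem

end MeanFieldERM

end

theorem theorem5 :
    ∃ C₁ : ℝ → ℝ, (∀ M, 0 < C₁ M) ∧
      ∀ (k d n : ℕ) (p : MeanFieldERM.Problem k d n),
        p.Regular →
      ∀ (μ₀ : Measure (EuclideanSpace ℝ (Fin k))) [IsProbabilityMeasure μ₀],
        IsCompact μ₀.support → μ₀.support ⊆ p.D →
      ∀ (Θ : ℝ → EuclideanSpace ℝ (Fin k) → EuclideanSpace ℝ (Fin k))
        (Θinf : EuclideanSpace ℝ (Fin k) → EuclideanSpace ℝ (Fin k)),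
        p.IsCharFlow μ₀ Θ →
        (∀ θ ∈ μ₀.support, Θinf θ ∈ p.D) →
        (∀ᵐ θ ∂μ₀, Tendsto (fun t => Θ t θ) atTop (𝓝 (Θinf θ))) →
        p.CurvatureBound (μ₀.map Θinf) →
        (MeanFieldERM.UniformRate μ₀ Θ Θinf ∨
          ∃ M : ℝ, p.BoundedBy (MeanFieldERM.trajectories μ₀ Θ) M ∧
            MeanFieldERM.WeightedIntegrability μ₀ Θ Θinf (C₁ M)) →
      ∀ (S : Type u) [MeasurableSpace S] (P : Measure S) [IsProbabilityMeasure P]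
        (ω₀ : Lp ℝ 2 μ₀ →ₗ[ℝ] Lp ℝ 2 P)
        (T : ℝ → EuclideanSpace ℝ (Fin k) → Lp (EuclideanSpace ℝ (Fin k)) 2 P),
        MeanFieldERM.IsGaussianFluctuation P μ₀ ω₀ →
        p.IsFlowFluctuation Θ ω₀ T →
        limsup (fun τ : ℝ => (ENNReal.ofReal τ)⁻¹ *
            ∫⁻ t in Ioc 0 τ, p.expSqNorm (p.g Θ ω₀ T t)) atTop
          ≤ ENNReal.ofReal (p.monteCarloBound (μ₀.map Θinf)) := by
  refine ⟨fun M => 2 * MeanFieldERM.Problem.hessLip M,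
    fun M => mul_pos two_pos (MeanFieldERM.Problem.hessLip_pos M), ?_⟩
  intro k d n p hp μ₀ _ hK _ Θ Θinf hΘ hinf hlim hcurv hrate S _ P _ ω₀ T hω hT
  obtain ⟨M, h, a, ha, hU, hexp⟩ :=
    MeanFieldERM.Problem.exists_convergesIn hp hK hΘ hinf hlim hrate
  exact h.limsup_average_le hω hT hcurv ha hU hexp
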